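/- For a tree $T$ (a nonempty finite connected acyclic graph) and $\alpha\in V(T)$, let $L_T(\alpha)=\mathbb R^{V(T)\setminus\{\alpha\}}$ with coordinates $x_\gamma(\alpha)$. The arboreal singularity $L_T$ is the quotient of $\coprod_{\alpha} L_T(\alpha)$ by the equivalence relation generated by identifying, for each edge $\{\alpha,\beta\}$, points $x(\alpha)\in L_T(\alpha)$ and $x(\beta)\in L_T(\beta)$ with $x_\beta(\alpha)=x_\alpha(\beta)\ge 0$ and $x_\gamma(\alpha)=x_\gamma(\beta)$ for all $\gamma\ne\alpha,\beta$. Multiplying all coordinates by $r\ge 0$ induces the dilation $x\mapsto r\cdot x$ of $L_T$. The link $L_T^{\mathrm{link}}\subset L_T$ is the image of the unit spheres of the spaces $L_T(\alpha)$. Let $P_T$ be the poset of correspondences of trees $p=(R\twoheadleftarrow S\hookrightarrow T)$, up to isomorphism of $R$, where $S$ is a subtree (a connected full subgraph) of $T$ and $R$ is a quotient tree of $S$ (each fiber of $V(S)\to V(R)$ is the vertex set of a subtree). Here $p\ge p'$ if and only if $p=q\circ p'$ for some correspondence $q=(R\twoheadleftarrow Q\hookrightarrow R')$, the composite being $R\twoheadleftarrow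 Q\times_{R'}S'\hookrightarrow T$. Its minimum is the identity correspondence $p_0$. The cell $L_T(p)$ is the set of points $x\in L_T$ such that $V(S)=\{\alpha : x\in L_T(\alpha)\}$ and $R$ is the quotient of $S$ by contracting those edges $\{\alpha,\beta\}$ of $S$ with $x_\beta(\alpha)=x_\alpha(\beta)>0$. Put $L_T^{\mathrm{link}}(p)=L_T^{\mathrm{link}}\cap L_T(p)$. For a space $X$ let $\mathrm{Cone}(X)=X\times[0,1)\cup_{X\times\{0\}}\mathrm{pt}$, with points written $[x,t]$ (for $X=\emptyset$ it is a point). Let $n\ge 1$, let $T_n$ be the $A_n$-tree, with vertices $v_1,\dots,v_n$ and edges $\{v_i,v_{i+1}\}$, $1\le i\le n-1$, and let $sk_{n-2}\Delta^n$ be the $(n-2)$-skeleton of the $n$-simplex with vertex set $[n]=\{0,1,\dots,n\}$ (empty for $n=1$). For nonempty $A\subset[n]$ let $\Delta_A^\circ$ be the relative interior of the face spanned by $A$. **Proposition.** There is an identification $L_{T_n}\simeq\mathrm{Cone}(sk_{n-2}\Delta^n)$ as regular cell complexes. Precisely, there are an isomorphism of posets $$\varphi: P_{T_n}\setminus\{p_0\}\to\{A\subset[n]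 : 1\le|A|\le n-1\}$$ (the target ordered by inclusion) and homeomorphisms $g: L_{T_n}^{\mathrm{link}}\to sk_{n-2}\Delta^n$ and $h: L_{T_n}\to\mathrm{Cone}(sk_{n-2}\Delta^n)$ such that 1. $g(L_{T_n}^{\mathrm{link}}(p))=\Delta_{\varphi(p)}^\circ$ for all $p\neq p_0$; 2. $h(L_{T_n}(p_0))$ consists of the cone point alone, and $h(L_{T_n}(p))=\Delta_{\varphi(p)}^\circ\times(0,1)$ for all $p\ne p_0$; 3. $h(r\cdot x)=[g(x),\,r/(1+r)]$ for all $x\in L_{T_n}^{\mathrm{link}}$ and $r\ge 0$. -/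

import Mathlib

open scoped NNReal

namespace Arboreal

section Singularity

variable {V : Type*} [Fintype V] [DecidableEq V]

/-- The Euclidean space `L_T(α) = ℝ^(V(T) \ {α})` with coordinates `x_γ(α)`, `γ ≠ α`. -/
abbrev Chart (V : Type*) (α : V) : Type _ := EuclideanSpace ℝ {γ : V // γ ≠ α}

/-- The edge gluings: for an edge `{α, β}`, the points `x ∈ L_T(α)` and `y ∈ L_T(β)` are
identified when `x_β(α) = y_α(β) ≥ 0` and all other coordinates agree. -/
def EdgeGlue (G : SimpleGraph V) (x y : Σ α : V, Chart V α) : Prop :=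
  ∃ h : G.Adj x.1 y.1,
    x.2 ⟨y.1, h.ne'⟩ = y.2 ⟨x.1, h.ne⟩ ∧ 0 ≤ x.2 ⟨y.1, h.ne'⟩ ∧
      ∀ (γ : V) (hx : γ ≠ x.1) (hy : γ ≠ y.1), x.2 ⟨γ, hx⟩ = y.2 ⟨γ, hy⟩

/-- The arboreal singularity `L_T`: the quotient of the disjoint union of the Euclidean spaces
`L_T(α)` by the equivalence relation generated by the edge gluings. -/
def Singularity (G : SimpleGraph V) : Type _ := Quot (EdgeGlue G)

/-- The quotient topology. -/
instance (G : SimpleGraph V) : TopologicalSpace (Singularity G) :=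
  inferInstanceAs (TopologicalSpace (Quot (EdgeGlue G)))

/-- The map `L_T(α) → L_T`. -/
def Singularity.mk (G : SimpleGraph V) (α : V) (y : Chart V α) : Singularity G :=
  Quot.mk (EdgeGlue G) ⟨α, y⟩

/-- Dilation of `L_T` by a factor `r ≥ 0`, multiplying all coordinates by `r`. -/
def Singularity.dilate {G : SimpleGraph V} (r : ℝ≥0) : Singularity G → Singularity G :=
  Quot.map (fun x => ⟨x.1, (r : ℝ) • x.2⟩) (by
    rintro x y ⟨h, h1, h2, h3⟩
    refine ⟨h, ?_, ?_, fun γ hx hy => ?_⟩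
    · change (r : ℝ) * x.2 ⟨y.1, h.ne'⟩ = (r : ℝ) * y.2 ⟨x.1, h.ne⟩
      rw [h1]
    · change 0 ≤ (r : ℝ) * x.2 ⟨y.1, h.ne'⟩
      exact mul_nonneg r.2 h2
    · change (r : ℝ) * x.2 ⟨γ, hx⟩ = (r : ℝ) * y.2 ⟨γ, hy⟩
      rw [h3 γ hx hy])

/-- The arboreal link: the points of `L_T` at unit distance from the central point. The gluings
preserve the Euclidean norms of the charts and the central point is the origin of each chart. -/
def link (G : SimpleGraph V) : Set (Singularity G) :=
  {x | ∃ (α : V) (y : Chart V α), ‖y‖ = 1 ∧ Singularity.mk G α y = x}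

/-- `v_x(α) = yes`: the point `x` lies in `L_T(α) ⊆ L_T`. -/
def Singularity.InChart {G : SimpleGraph V} (x : Singularity G) (α : V) : Prop :=
  ∃ y : Chart V α, Singularity.mk G α y = x

/-- `α, β ∈ V(S)` are joined by an edge of `S` with `e_x({α, β}) = +`, that is,
`x_β(α) = x_α(β) > 0` at `x`. -/
def Singularity.PosEdge {G : SimpleGraph V} (x : Singularity G) (α β : V) : Prop :=
  ∃ h : G.Adj α β, x.InChart α ∧ x.InChart β ∧
    ∃ y : Chart V α, Singularity.mk G α y = x ∧ 0 < y ⟨β, h.ne'⟩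

end Singularity

section Correspondences

variable {V : Type*}

/-- A correspondence of trees `R ↞ S ↪ T`, where `S` is a subtree of `T` and `R` a quotient tree
of `S`, up to isomorphism of `R`. The subtree is given by its vertex set and the quotient by its
partition of `S` into fibers, which are subtrees. A full subgraph of a tree is a subtree if and only
if it is connected (in particular nonempty). -/
@[ext]
structure Correspondence (G : SimpleGraph V) where
  /-- the vertices of `S` -/
  carrier : Set V
  connected : (G.induce carrier).Connected
  /-- two vertices of `S` are related if they have the same image in `R` -/
  rel : Setoid carrier
  fiber_connected : ∀ s : carrier, ((G.induce carrier).induce {t | rel t s}).Connected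

namespace Correspondence

variable {G : SimpleGraph V}

/-- The quotient tree `R`: its vertices are the fibers, and two distinct fibers are adjacent if
they are joined by an edge of `S`. -/
def target (p : Correspondence G) : SimpleGraph (Quotient p.rel) where
  Adj a b := a ≠ b ∧ ∃ s t : p.carrier, Quotient.mk p.rel s = a ∧ Quotient.mk p.rel t = b ∧
    G.Adj s t
  symm := by
    constructor
    rintro a b ⟨h, s, t, hs, ht, hst⟩
    exact ⟨h.symm, t, s, ht, hs, hst.symm⟩
  loopless := ⟨fun _ h => h.1 rfl⟩

/-- `p = q ∘ p'`, for `q = (R ↞ Q ↪ R')` and `p' = (R' ↞ S' ↪ T)`: the composite is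
`R ↞ Q ×_{R'} S' ↪ T`. -/
def IsComp (p p' : Correspondence G) (q : Correspondence p'.target) : Prop :=
  (∀ v : V, v ∈ p.carrier ↔ ∃ h : v ∈ p'.carrier, Quotient.mk p'.rel ⟨v, h⟩ ∈ q.carrier) ∧
  ∀ (s t : p.carrier) (s' t' : p'.carrier) (a b : q.carrier),
    (s : V) = s' → (t : V) = t' → Quotient.mk p'.rel s' = a → Quotient.mk p'.rel t' = b →
      (p.rel s t ↔ q.rel a b)

/-- The order on correspondences: `p ≥ p'` if `p = q ∘ p'` for some correspondence `q`. -/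
instance : LE (Correspondence G) where
  le p' p := ∃ q : Correspondence p'.target, IsComp p p' q

/-- The identity correspondence `p₀ = (T ↞ T ↪ T)`. -/
def identity (hG : G.Connected) : Correspondence G where
  carrier := Set.univ
  connected := (SimpleGraph.induceUnivIso G).connected_iff.mpr hG
  rel := ⊥
  fiber_connected s := by
    have : Subsingleton {t : (Set.univ : Set V) | (⊥ : Setoid _) t s} :=
      ⟨fun a b => Subtype.ext ((show a.1 = s from a.2).trans (show b.1 = s from b.2).symm)⟩
    exact { preconnected := SimpleGraph.Preconnected.of_subsingleton
            nonempty := ⟨⟨s, rfl⟩⟩ }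

/-- The cell `L_T(p) ⊆ L_T`: the points `x` that lead to the correspondence `p`. The vertices of
`S` are those `α` with `x ∈ L_T(α)`, and `R` is obtained from `S` by contracting the edges on which
`e_x = +`. -/
def cell [Fintype V] [DecidableEq V] (p : Correspondence G) : Set (Singularity G) :=
  {x | (∀ α : V, α ∈ p.carrier ↔ x.InChart α) ∧
    ∀ s t : p.carrier, p.rel s t ↔ Relation.EqvGen x.PosEdge (s : V) (t : V)}

end Correspondence

/-- The `A_n`-tree: `n` vertices, with an edge joining consecutive ones. -/
abbrev anTree (n : ℕ) : SimpleGraph (Fin n) := SimpleGraph.pathGraph n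

theorem anTree_connected {n : ℕ} (hn : 1 ≤ n) : (anTree n).Connected := by
  obtain ⟨m, rfl⟩ := Nat.exists_eq_add_of_le' hn
  exact SimpleGraph.pathGraph_connected m

end Correspondences

section Simplex

/-- The closed face of the simplex `Δ^n` spanned by the set `A` of vertices. -/
def closedFace {n : ℕ} (A : Finset (Fin (n + 1))) : Set (Fin (n + 1) → ℝ) :=
  {x | x ∈ stdSimplex ℝ (Fin (n + 1)) ∧ ∀ i, i ∉ A → x i = 0}

/-- The relative interior of the face of `Δ^n` spanned by `A`. -/
def openFace {n : ℕ} (A : Finset (Fin (n + 1))) : Set (Fin (n + 1) → ℝ) :=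
  {x | x ∈ stdSimplex ℝ (Fin (n + 1)) ∧ ∀ i, x i ≠ 0 ↔ i ∈ A}

/-- The `k`-skeleton of `Δ^n`: the union of the faces of dimension at most `k`. -/
def skeleton (n : ℕ) (k : ℤ) : Set (Fin (n + 1) → ℝ) :=
  {x | ∃ A : Finset (Fin (n + 1)), A.Nonempty ∧ (A.card : ℤ) - 1 ≤ k ∧ x ∈ closedFace A}

end Simplex

section Cone

variable (X : Type*)

/-- The gluing of `X × [0, 1)` with a point along `X × {0}`. -/
inductive ConeGlue : (X × Set.Ico (0 : ℝ) 1) ⊕ Unit → (X × Set.Ico (0 : ℝ) 1) ⊕ Unit → Prop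
  | glue (x : X) (t : Set.Ico (0 : ℝ) 1) (ht : (t : ℝ) = 0) :
      ConeGlue (Sum.inl (x, t)) (Sum.inr ())

/-- The cone `X × [0, 1) ∪_{X × {0}} pt`; it is a point if `X` is empty. -/
def Cone : Type _ := Quot (ConeGlue X)

/-- The quotient topology. -/
instance [TopologicalSpace X] : TopologicalSpace (Cone X) :=
  inferInstanceAs (TopologicalSpace (Quot (ConeGlue X)))

/-- The cone point. -/
def Cone.apex : Cone X := Quot.mk (ConeGlue X) (Sum.inr ())

variable {X}

/-- The point `[x, t]` of the cone. -/
def Cone.mk (x : X) (t : Set.Ico (0 : ℝ) 1) : Cone X := Quot.mk (ConeGlue X) (Sum.inl (x, t))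

/-- The open cell `c × (0, 1)` of the cone over a cell `c` of the base. -/
def Cone.over (c : Set X) : Set (Cone X) :=
  {z | ∃ x ∈ c, ∃ t : Set.Ico (0 : ℝ) 1, 0 < (t : ℝ) ∧ Cone.mk x t = z}

/-- The rescaling `r ↦ r / (1 + r)` of `[0, ∞)` to `[0, 1)`. -/
noncomputable def coneRadius (r : ℝ≥0) : Set.Ico (0 : ℝ) 1 :=
  ⟨(r : ℝ) / (1 + r), div_nonneg r.2 (add_nonneg zero_le_one r.2),
    (div_lt_one (add_pos_of_pos_of_nonneg one_pos r.2)).mpr (lt_one_add _)⟩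

end Cone

end Arboreal

namespace Arboreal

/-! ### Connectedness of graphs by surjections and by interval labellings -/

section Connectivity

/-! Both sides are controlled by the `n + 1` gaps `0, …, n` of the path, the vertex `k` lying
between the gaps `k` and `k + 1`.

Combinatorially, a correspondence is a set `B` of at least two gaps: its extremal elements bound the
subtree, its inner elements are the edges that are not contracted. Passing to a larger
correspondence removes gaps (`ofGaps_le_ofGaps`, `exists_eq_ofGaps`), so complements of gap sets
give the face poset.

Geometrically, `L_T` unfolds to the set of nonnegative vectors in `ℝ^(n+1)` with at least two zeros.
In the chart of a vertex `a`, each coordinate is placed at the gap on the side of its vertex facing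
`a`; call it `w_i`, with `w_0 = w_n = 0`. Left of `a` put `y_i = w_i⁺ + ∑_{i < j ≤ a} w_j⁻`, and
symmetrically on the right. This is inverted by `w_i = y_i - min (y_0, …, y_{i-1})`, and its image
consists of the nonnegative vectors with a zero on each side of `a`. A gluing moves `a` across a gap
of nonnegative weight, which contributes no negative part, so the charts agree
(`chartUnfold_eq_of_edgeGlue`); together they give `unfoldHomeomorph`.

A point lies in the chart of `a` exactly when its unfolding has zeros on both sides of `a`, and an
edge inside its subtree is positive exactly when the value at its gap is. Hence the cell of a point
is given by the zero set of its unfolding (`mem_cell_ofGaps_iff`). The unfolding commutes with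
dilation, so normalizing by the coordinate sum instead of the norm takes the link to the skeleton,
and polar coordinates give the cone. -/

theorem connected_of_map {V W : Type*} {G : SimpleGraph V} {H : SimpleGraph W} (f : V → W)
    (hf : Function.Surjective f) (hadj : ∀ u v, G.Adj u v → f u = f v ∨ H.Adj (f u) (f v))
    (hG : G.Connected) : H.Connected := by
  have key : ∀ u v, G.Reachable u v → H.Reachable (f u) (f v) := by
    rintro u v ⟨w⟩
    induction w with
    | nil => exact SimpleGraph.Reachable.refl _
    | cons h _ ih =>
      rcases hadj _ _ h with h' | h'
      · rw [h']; exact ih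
      · exact h'.reachable.trans ih
  have := hG.nonempty.map f
  refine { preconnected := fun a b => ?_, nonempty := this }
  obtain ⟨u, rfl⟩ := hf a
  obtain ⟨v, rfl⟩ := hf b
  exact key u v (hG.preconnected u v)

/-- A function on a connected graph that grows by at most one along edges takes all intermediate
values. -/
theorem exists_eq_of_connected {W : Type*} {H : SimpleGraph W} (hH : H.Connected) (f : W → ℕ)
    (hf : ∀ u v, H.Adj u v → f v ≤ f u + 1) {u v : W} {m : ℕ} (hu : f u ≤ m) (hv : m ≤ f v) :
    ∃ w, f w = m := by
  obtain ⟨w⟩ := hH.preconnected u v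
  induction w with
  | @nil u => exact ⟨u, le_antisymm hu hv⟩
  | @cons u w v h _ ih =>
    rcases hu.eq_or_lt with h' | h'
    · exact ⟨u, h'⟩
    · exact ih ((hf _ _ h).trans h') hv

/-- A graph whose vertices are labelled injectively by the elements of an interval, with consecutive
ones adjacent, is connected. -/
theorem connected_of_interval {W : Type*} {H : SimpleGraph W} [Nonempty W] (f : W → ℕ)
    (hinj : Function.Injective f) (hadj : ∀ u v, f u + 1 = f v → H.Adj u v)
    (hconv : ∀ u v m, f u ≤ m → m ≤ f v → ∃ w, f w = m) : H.Connected := by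
  have key : ∀ d u v, f v = f u + d → H.Reachable u v := by
    intro d
    induction d with
    | zero => intro u v h; rw [hinj h]
    | succ d ih =>
      intro u v h
      obtain ⟨w, hw⟩ := hconv u v (f u + d) (by omega) (by omega)
      exact (ih u w hw).trans (hadj w v (by omega)).reachable
  refine { preconnected := fun u v => ?_, nonempty := inferInstance }
  rcases le_total (f u) (f v) with h | h
  · exact key (f v - f u) u v (by omega)
  · exact (key (f u - f v) v u (by omega)).symm

end Connectivity

/-! ### The order on correspondences in terms of vertices of the tree -/

namespace Correspondence

variable {V : Type*} {G : SimpleGraph V}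

/-- Two vertices of `T` lie in the subtree `S` and have the same image in `R`. -/
def Related (p : Correspondence G) (u v : V) : Prop :=
  ∃ (hu : u ∈ p.carrier) (hv : v ∈ p.carrier), p.rel ⟨u, hu⟩ ⟨v, hv⟩

/-- The factor `q` is the push-forward of `p`: its subtree is the image of `S` in `R'`, and its
fibers are the images of the fibers of `p`. Connectedness passes to images. -/
theorem le_of_related {p' p : Correspondence G} (hc : p.carrier ⊆ p'.carrier)
    (hr : ∀ u v, u ∈ p.carrier → p'.Related u v → p.Related u v) : p' ≤ p := by
  let Q : Set (Quotient p'.rel) :=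
    {c | ∃ s : p.carrier, Quotient.mk p'.rel ⟨s, hc s.2⟩ = c}
  let f : p.carrier → Q := fun s => ⟨Quotient.mk p'.rel ⟨s, hc s.2⟩, s, rfl⟩
  have hf : Function.Surjective f := by
    rintro ⟨c, s, hs⟩
    exact ⟨s, Subtype.ext hs⟩
  have hfrel : ∀ s t, f s = f t → p.rel s t := by
    intro s t h
    have h1 : p'.rel ⟨s, hc s.2⟩ ⟨t, hc t.2⟩ := Quotient.exact (congrArg Subtype.val h)
    obtain ⟨_, _, h2⟩ := hr s t s.2 ⟨_, _, h1⟩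
    exact h2
  have hfadj : ∀ s t : p.carrier, G.Adj s t → f s = f t ∨ p'.target.Adj (f s).1 (f t).1 := by
    intro s t h
    by_cases e : f s = f t
    · exact Or.inl e
    · exact Or.inr ⟨fun h' => e (Subtype.ext h'), _, _, rfl, rfl, h⟩
  -- Transitivity needs `hfrel`: two preimages in `S` of the same vertex of `R'` are already related
  -- by `p`.
  let R : Setoid Q :=
    { r := fun a b => ∃ s t, f s = a ∧ f t = b ∧ p.rel s t
      iseqv := by
        refine ⟨fun a => ?_, ?_, ?_⟩
        · obtain ⟨s, rfl⟩ := hf a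
          exact ⟨s, s, rfl, rfl, p.rel.refl s⟩
        · rintro a b ⟨s, t, hs, ht, h⟩
          exact ⟨t, s, ht, hs, p.rel.symm h⟩
        · rintro a b c ⟨s, t, hs, ht, h⟩ ⟨s', t', hs', ht', h'⟩
          exact ⟨s, t', hs, ht',
            p.rel.trans h (p.rel.trans (hfrel t s' (ht.trans hs'.symm)) h')⟩ }
  have hR : ∀ s t, R (f s) (f t) ↔ p.rel s t := by
    refine fun s t => ⟨?_, fun h => ⟨s, t, rfl, rfl, h⟩⟩
    rintro ⟨s', t', hs, ht, h⟩
    exact p.rel.trans (hfrel _ _ hs.symm) (p.rel.trans h (hfrel _ _ ht))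
  refine ⟨⟨Q, ?_, R, ?_⟩, ?_, ?_⟩
  · exact connected_of_map f hf (fun s t h => hfadj s t h) p.connected
  · intro a
    obtain ⟨s, rfl⟩ := hf a
    refine connected_of_map (G := (G.induce p.carrier).induce {t | p.rel t s})
      (fun t => ⟨f t.1, (hR _ _).mpr t.2⟩) ?_ ?_ (p.fiber_connected s)
    · rintro ⟨b, hb⟩
      obtain ⟨t, rfl⟩ := hf b
      exact ⟨⟨t, (hR _ _).mp hb⟩, rfl⟩
    · intro t t' h
      rcases hfadj t.1 t'.1 h with h' | h'
      · exact Or.inl (Subtype.ext h')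
      · exact Or.inr h'
  · refine fun v => ⟨fun hv => ⟨hc hv, ⟨v, hv⟩, rfl⟩, ?_⟩
    rintro ⟨h, s, hs⟩
    obtain ⟨_, h2, _⟩ := hr s v s.2 ⟨_, h, Quotient.exact hs⟩
    exact h2
  · rintro s t ⟨_, hs⟩ ⟨_, ht⟩ a b rfl rfl ha hb
    have ha' : f s = a := Subtype.ext ha
    have hb' : f t = b := Subtype.ext hb
    rw [← ha', ← hb']
    exact (hR s t).symm

/-- Eliminates `q` from the order. The second condition says at once that `S` is a union of fibers
of `p'` and that on `S` the partition of `p` is coarser. -/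
theorem le_iff {p' p : Correspondence G} :
    p' ≤ p ↔ p.carrier ⊆ p'.carrier ∧
      ∀ u v, u ∈ p.carrier → p'.Related u v → p.Related u v := by
  refine ⟨?_, fun h => le_of_related h.1 h.2⟩
  rintro ⟨q, h1, h2⟩
  refine ⟨fun v hv => ((h1 v).mp hv).1, ?_⟩
  rintro u v hu ⟨hu', hv', h⟩
  obtain ⟨_, hq⟩ := (h1 u).mp hu
  have e : Quotient.mk p'.rel ⟨u, hu'⟩ = Quotient.mk p'.rel ⟨v, hv'⟩ := Quotient.sound h
  have hv : v ∈ p.carrier := (h1 v).mpr ⟨hv', e ▸ hq⟩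
  exact ⟨hu, hv, (h2 ⟨u, hu⟩ ⟨v, hv⟩ ⟨u, hu'⟩ ⟨v, hv'⟩ ⟨_, hq⟩ ⟨_, hq⟩ rfl rfl rfl e.symm).mpr
    (q.rel.refl _)⟩

theorem ext_related {p p' : Correspondence G} (h : ∀ u v, p.Related u v ↔ p'.Related u v) :
    p = p' := by
  obtain ⟨C, hC, r, hr⟩ := p
  obtain ⟨C', hC', r', hr'⟩ := p'
  have e : C = C' := by
    ext u
    exact ⟨fun hu => ((h u u).mp ⟨hu, hu, r.refl _⟩).1, fun hu => ((h u u).mpr ⟨hu, hu, r'.refl _⟩).1⟩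
  subst e
  have e : r = r' := by
    ext s t
    exact ⟨fun hst => ((h s t).mp ⟨s.2, t.2, hst⟩).2.2, fun hst => ((h s t).mpr ⟨s.2, t.2, hst⟩).2.2⟩
  subst e
  rfl

/-! ### Correspondences of the path as sets of gaps -/

section Path

variable {n : ℕ}

theorem anTree_adj {k l : Fin n} : (anTree n).Adj k l ↔ k.1 + 1 = l.1 ∨ l.1 + 1 = k.1 := by
  rw [SimpleGraph.pathGraph_adj]

theorem le_succ_of_adj {k l : Fin n} (h : (anTree n).Adj k l) : l.1 ≤ k.1 + 1 := by
  rcases anTree_adj.mp h with h | h <;> omega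

/-- The correspondence of `A_n` given by the set `B` of gaps: the vertex `k` lies between the gaps
`k` and `k + 1`, the subtree is spanned by the vertices between the extremal elements of `B`, and an
edge of it is contracted if its gap is not in `B`. -/
def ofGaps (B : Finset (Fin (n + 1))) (hB : 2 ≤ B.card) : Correspondence (anTree n) where
  carrier := {k | (∃ b ∈ B, b.1 ≤ k.1) ∧ ∃ b ∈ B, k.1 < b.1}
  connected := by
    obtain ⟨b, hb, c, hc, hbc⟩ := Finset.one_lt_card.mp hB
    have : Nonempty {k : Fin n | (∃ b ∈ B, b.1 ≤ k.1) ∧ ∃ b ∈ B, k.1 < b.1} := by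
      rcases lt_or_gt_of_ne hbc with h | h
      · exact ⟨⟨⟨b.1, by omega⟩, ⟨b, hb, le_rfl⟩, ⟨c, hc, h⟩⟩⟩
      · exact ⟨⟨⟨c.1, by omega⟩, ⟨c, hc, le_rfl⟩, ⟨b, hb, h⟩⟩⟩
    refine connected_of_interval (fun k => k.1.1)
      (fun k l h => Subtype.ext (Fin.ext h)) (fun k l h => anTree_adj.mpr (Or.inl h)) ?_
    rintro ⟨k, ⟨b, hb, hbk⟩, _⟩ ⟨l, _, ⟨c, hc, hlc⟩⟩ m h1 h2
    dsimp only at h1 h2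
    exact ⟨⟨⟨m, by omega⟩, ⟨b, hb, by dsimp only; omega⟩, ⟨c, hc, by dsimp only; omega⟩⟩, rfl⟩
  rel :=
    { r := fun k l => ∀ b ∈ B, b.1 ≤ k.1.1 ↔ b.1 ≤ l.1.1
      iseqv := ⟨fun _ _ _ => Iff.rfl, fun h b hb => (h b hb).symm,
        fun h h' b hb => (h b hb).trans (h' b hb)⟩ }
  fiber_connected s := by
    refine @connected_of_interval _ _ ⟨⟨s, fun _ _ => Iff.rfl⟩⟩ (fun k => k.1.1.1)
      (fun k l h => Subtype.ext (Subtype.ext (Fin.ext h)))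
      (fun k l h => anTree_adj.mpr (Or.inl h)) ?_
    rintro ⟨⟨k, ⟨b, hb, hbk⟩, _⟩, hk⟩ ⟨⟨l, _, ⟨c, hc, hlc⟩⟩, hl⟩ m h1 h2
    dsimp only at h1 h2
    refine ⟨⟨⟨⟨m, by omega⟩, ⟨b, hb, by dsimp only; omega⟩, ⟨c, hc, by dsimp only; omega⟩⟩, ?_⟩, rfl⟩
    intro b hb
    have h3 := hk b hb
    have h4 := hl b hb
    dsimp only at h3 h4 ⊢
    omega

theorem mem_ofGaps {B : Finset (Fin (n + 1))} {hB : 2 ≤ B.card} {k : Fin n} :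
    k ∈ (ofGaps B hB).carrier ↔ (∃ b ∈ B, b.1 ≤ k.1) ∧ ∃ b ∈ B, k.1 < b.1 := Iff.rfl

theorem related_ofGaps {B : Finset (Fin (n + 1))} {hB : 2 ≤ B.card} {k l : Fin n} :
    (ofGaps B hB).Related k l ↔ k ∈ (ofGaps B hB).carrier ∧ l ∈ (ofGaps B hB).carrier ∧
      ∀ b ∈ B, b.1 ≤ k.1 ↔ b.1 ≤ l.1 :=
  ⟨fun ⟨h1, h2, h3⟩ => ⟨h1, h2, h3⟩, fun ⟨h1, h2, h3⟩ => ⟨h1, h2, h3⟩⟩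

/-- Suppose `b` is in `B` but not in `B'`. A second gap of `B` puts one of the vertices `b - 1`, `b`
into the smaller subtree. As `B'` does not contain `b`, it neither ends nor separates there, so both
vertices lie in one fiber for `B'`; but `b` separates them for `B`. -/
theorem ofGaps_le_ofGaps {B B' : Finset (Fin (n + 1))} {hB : 2 ≤ B.card} {hB' : 2 ≤ B'.card} :
    ofGaps B' hB' ≤ ofGaps B hB ↔ B ⊆ B' := by
  rw [le_iff]
  constructor
  · rintro ⟨h1, h2⟩ b hb
    by_contra hbB
    have hne : ∀ c ∈ B', c.1 ≠ b.1 := fun c hc h => hbB (Fin.ext h ▸ hc)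
    have key : ∀ k l : Fin n, k.1 + 1 = b.1 → l.1 = b.1 →
        ((ofGaps B' hB').Related k l) → ¬ (ofGaps B hB).Related k l := by
      intro k l hk hl _ h
      have := (related_ofGaps.mp h).2.2 b hb
      omega
    have rel' : ∀ k l : Fin n, k.1 + 1 = b.1 → l.1 = b.1 →
        k ∈ (ofGaps B' hB').carrier → l ∈ (ofGaps B' hB').carrier →
        (ofGaps B' hB').Related k l := by
      intro k l hk hl h h'
      refine related_ofGaps.mpr ⟨h, h', fun c hc => ?_⟩
      have := hne c hc
      omega
    obtain ⟨c, hc, hcb⟩ := Finset.exists_mem_ne (by omega : 1 < B.card) b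
    rcases lt_or_gt_of_ne hcb with h | h
    · have hbn := b.2
      have h : c.1 < b.1 := h
      have hk : (⟨b.1 - 1, by omega⟩ : Fin n) ∈ (ofGaps B hB).carrier :=
        ⟨⟨c, hc, by dsimp only; omega⟩, ⟨b, hb, by dsimp only; omega⟩⟩
      obtain ⟨⟨d, hd, hdb⟩, ⟨e, he, heb⟩⟩ := mem_ofGaps.mp (h1 hk)
      have := hne e he
      dsimp only at hdb heb
      have hl : (⟨b.1, by omega⟩ : Fin n) ∈ (ofGaps B' hB').carrier :=
        ⟨⟨d, hd, by dsimp only; omega⟩, ⟨e, he, by dsimp only; omega⟩⟩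
      have hr := rel' ⟨b.1 - 1, by omega⟩ ⟨b.1, by omega⟩ (by dsimp only; omega) rfl (h1 hk) hl
      exact key _ _ (by dsimp only; omega) rfl hr (h2 _ _ hk hr)
    · have h : b.1 < c.1 := h
      have hk : (⟨b.1, by omega⟩ : Fin n) ∈ (ofGaps B hB).carrier :=
        ⟨⟨b, hb, le_rfl⟩, ⟨c, hc, h⟩⟩
      obtain ⟨⟨d, hd, hdb⟩, ⟨e, he, heb⟩⟩ := mem_ofGaps.mp (h1 hk)
      have := hne d hd
      dsimp only at hdb heb
      have hl : (⟨b.1 - 1, by omega⟩ : Fin n) ∈ (ofGaps B' hB').carrier :=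
        ⟨⟨d, hd, by dsimp only; omega⟩, ⟨e, he, by dsimp only; omega⟩⟩
      have hr := rel' ⟨b.1 - 1, by omega⟩ ⟨b.1, by omega⟩ (by dsimp only; omega) rfl hl (h1 hk)
      have hr' : (ofGaps B' hB').Related ⟨b.1, by omega⟩ ⟨b.1 - 1, by omega⟩ :=
        ⟨hr.2.1, hr.1, (ofGaps B' hB').rel.symm hr.2.2⟩
      have hs := h2 _ _ hk hr'
      exact key _ _ (by dsimp only; omega) rfl hr
        ⟨hs.2.1, hs.1, (ofGaps B hB).rel.symm hs.2.2⟩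
  · intro h
    refine ⟨?_, ?_⟩
    · rintro k ⟨⟨b, hb, hb'⟩, ⟨c, hc, hc'⟩⟩
      exact ⟨⟨b, h hb, hb'⟩, ⟨c, h hc, hc'⟩⟩
    · intro k l hk hkl
      obtain ⟨_, _, hr⟩ := related_ofGaps.mp hkl
      refine related_ofGaps.mpr ⟨hk, ?_, fun b hb => hr b (h hb)⟩
      obtain ⟨⟨b, hb, hb'⟩, ⟨c, hc, hc'⟩⟩ := hk
      refine ⟨⟨b, hb, (hr b (h hb)).mp hb'⟩, ⟨c, hc, ?_⟩⟩
      have := hr c (h hc)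
      omega

theorem ofGaps_injective {B B' : Finset (Fin (n + 1))} {hB : 2 ≤ B.card} {hB' : 2 ≤ B'.card}
    (h : ofGaps B hB = ofGaps B' hB') : B = B' := by
  have hle : ∀ p : Correspondence (anTree n), p ≤ p := fun p =>
    le_iff.mpr ⟨subset_rfl, fun _ _ _ h => h⟩
  exact subset_antisymm (ofGaps_le_ofGaps.mp (h ▸ hle _ : ofGaps B' hB' ≤ ofGaps B hB))
    (ofGaps_le_ofGaps.mp (h ▸ hle _ : ofGaps B hB ≤ ofGaps B' hB'))

/-- A walk inside the subtree raises the label by at most one per step, so it cannot jump over `l`.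
-/
theorem mem_of_between (p : Correspondence (anTree n)) {k l m : Fin n} (hk : k ∈ p.carrier)
    (hm : m ∈ p.carrier) (hkl : k ≤ l) (hlm : l ≤ m) : l ∈ p.carrier := by
  obtain ⟨w, hw⟩ := exists_eq_of_connected p.connected (fun k => k.1.1)
    (fun u v h => le_succ_of_adj (k := u.1) (l := v.1) h)
    (u := ⟨k, hk⟩) (v := ⟨m, hm⟩) hkl hlm
  have : w.1 = l := Fin.ext hw
  exact this ▸ w.2

theorem related_of_between (p : Correspondence (anTree n)) {k l m : Fin n} (h : p.Related k m)
    (hkl : k ≤ l) (hlm : l ≤ m) : p.Related k l := by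
  obtain ⟨hk, hm, hr⟩ := h
  obtain ⟨w, hw⟩ := exists_eq_of_connected (p.fiber_connected ⟨k, hk⟩) (fun k => k.1.1.1)
    (fun u v h => le_succ_of_adj (k := u.1.1) (l := v.1.1) h)
    (u := ⟨⟨k, hk⟩, p.rel.refl _⟩) (v := ⟨⟨m, hm⟩, p.rel.symm hr⟩) hkl hlm
  have : w.1.1 = l := Fin.ext hw
  subst this
  exact ⟨hk, w.1.2, p.rel.symm w.2⟩

theorem Related.symm {V : Type*} {G : SimpleGraph V} {p : Correspondence G} {u v : V}
    (h : p.Related u v) : p.Related v u := ⟨h.2.1, h.1, p.rel.symm h.2.2⟩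

theorem Related.trans {V : Type*} {G : SimpleGraph V} {p : Correspondence G} {u v w : V}
    (h : p.Related u v) (h' : p.Related v w) : p.Related u w :=
  ⟨h.1, h'.2.1, p.rel.trans h.2.2 h'.2.2⟩

-- `B` collects the gaps bordering a vertex of the subtree and not contracted by `p`; the two outer
-- gaps of the subtree qualify because one of their neighbours is missing.
open Classical in
theorem exists_eq_ofGaps (p : Correspondence (anTree n)) : ∃ B hB, p = ofGaps B hB := by
  let B : Finset (Fin (n + 1)) := Finset.univ.filter fun b =>
    (∃ k ∈ p.carrier, k.1 + 1 = b.1 ∨ k.1 = b.1) ∧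
      ¬ ∃ k l, k.1 + 1 = b.1 ∧ l.1 = b.1 ∧ p.Related k l
  have hmem : ∀ b, b ∈ B ↔ (∃ k ∈ p.carrier, k.1 + 1 = b.1 ∨ k.1 = b.1) ∧
      ¬ ∃ k l, k.1 + 1 = b.1 ∧ l.1 = b.1 ∧ p.Related k l := fun b => by simp [B]
  have hlo : ∀ k ∈ p.carrier, ∃ b ∈ B, b.1 ≤ k.1 := by
    intro k hk
    obtain ⟨m, hm, hmin⟩ := Set.exists_min_image p.carrier id (Set.toFinite _) ⟨k, hk⟩
    refine ⟨m.castSucc, (hmem _).mpr ⟨⟨m, hm, Or.inr rfl⟩, ?_⟩, hmin k hk⟩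
    rintro ⟨k', l, h1, h2, h3, _⟩
    have : m.1 ≤ k'.1 := hmin k' h3
    simp only [Fin.val_castSucc] at h1
    omega
  have hhi : ∀ k ∈ p.carrier, ∃ b ∈ B, k.1 < b.1 := by
    intro k hk
    obtain ⟨m, hm, hmax⟩ := Set.exists_max_image p.carrier id (Set.toFinite _) ⟨k, hk⟩
    refine ⟨m.succ, (hmem _).mpr ⟨⟨m, hm, Or.inl rfl⟩, ?_⟩, ?_⟩
    · rintro ⟨k', l, h1, h2, _, h3, _⟩
      have : l.1 ≤ m.1 := hmax l h3
      simp only [Fin.val_succ] at h2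
      omega
    · have : k.1 ≤ m.1 := hmax k hk
      simp only [Fin.val_succ]
      omega
  have hB : 2 ≤ B.card := by
    obtain ⟨⟨k, hk⟩⟩ := p.connected.nonempty
    obtain ⟨b, hb, hb'⟩ := hlo k hk
    obtain ⟨c, hc, hc'⟩ := hhi k hk
    exact Finset.one_lt_card.mpr ⟨b, hb, c, hc, fun h => by subst h; omega⟩
  have hcar : ∀ k, k ∈ (ofGaps B hB).carrier ↔ k ∈ p.carrier := by
    refine fun k => ⟨?_, fun hk => ⟨hlo k hk, hhi k hk⟩⟩
    rintro ⟨⟨b, hb, hb'⟩, ⟨c, hc, hc'⟩⟩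
    obtain ⟨⟨l, hl, hl'⟩, _⟩ := (hmem b).mp hb
    obtain ⟨⟨m, hm, hm'⟩, _⟩ := (hmem c).mp hc
    exact p.mem_of_between hl hm (Fin.le_def.mpr (by omega)) (Fin.le_def.mpr (by omega))
  have hone : ∀ d (k l : Fin n), l.1 = k.1 + d → (p.Related k l ↔ (ofGaps B hB).Related k l) := by
    intro d k l hd
    constructor
    · intro h
      refine related_ofGaps.mpr ⟨(hcar _).mpr h.1, (hcar _).mpr h.2.1, fun b hb => ?_⟩
      by_contra hne
      have hk : k.1 < b.1 := by omega
      have hl : b.1 ≤ l.1 := by omega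
      have h1 := p.related_of_between (l := ⟨b.1 - 1, by omega⟩) h
        (Fin.le_def.mpr (by dsimp only; omega)) (Fin.le_def.mpr (by dsimp only; omega))
      have h2 := p.related_of_between (l := ⟨b.1, by omega⟩) h
        (Fin.le_def.mpr (by dsimp only; omega)) (Fin.le_def.mpr (by dsimp only; omega))
      exact ((hmem b).mp hb).2 ⟨_, _, by dsimp only; omega, rfl, h1.symm.trans h2⟩
    · intro h
      obtain ⟨hk, hl, hr⟩ := related_ofGaps.mp h
      rw [hcar] at hk hl
      clear h
      induction d generalizing l with
      | zero =>
        have : l = k := Fin.ext hd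
        subst this
        exact ⟨hk, hk, p.rel.refl _⟩
      | succ d ih =>
        let m : Fin n := ⟨k.1 + d, by omega⟩
        have hmv : m.1 = k.1 + d := rfl
        have hm : m ∈ p.carrier :=
          p.mem_of_between hk hl (Fin.le_def.mpr (by omega)) (Fin.le_def.mpr (by omega))
        have h1 := ih m rfl hm (fun b hb => by have := hr b hb; omega)
        refine h1.trans ?_
        by_contra hml
        -- If the last edge were not contracted, its gap would lie in `B` and separate `k` from `l`,
        -- against `hr`.
        have hb : l.castSucc ∈ B := by
          refine (hmem _).mpr ⟨⟨l, hl, Or.inr rfl⟩, ?_⟩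
          rintro ⟨k', l', e1, e2, h3⟩
          simp only [Fin.val_castSucc] at e1 e2
          have e3 : k' = m := Fin.ext (by omega)
          have e4 : l' = l := Fin.ext (by omega)
          exact hml (e3 ▸ e4 ▸ h3)
        have := hr _ hb
        simp only [Fin.val_castSucc] at this
        omega
  refine ⟨B, hB, ext_related fun k l => ?_⟩
  rcases le_total k.1 l.1 with h | h
  · exact hone (l.1 - k.1) k l (by omega)
  · have := hone (k.1 - l.1) l k (by omega)
    exact ⟨fun h => (this.mp h.symm).symm, fun h => (this.mpr h.symm).symm⟩

theorem ofGaps_univ (hn : 1 ≤ n) (hB : 2 ≤ (Finset.univ : Finset (Fin (n + 1))).card) :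
    ofGaps Finset.univ hB = identity (anTree_connected hn) := by
  have hcar : ∀ k, k ∈ (ofGaps (n := n) Finset.univ hB).carrier := fun k =>
    ⟨⟨0, Finset.mem_univ _, Nat.zero_le _⟩, ⟨Fin.last n, Finset.mem_univ _, k.2⟩⟩
  refine ext_related fun k l => ⟨fun h => ?_, fun ⟨_, _, h⟩ => ?_⟩
  · have h1 := (related_ofGaps.mp h).2.2 k.castSucc (Finset.mem_univ _)
    have h2 := (related_ofGaps.mp h).2.2 l.castSucc (Finset.mem_univ _)
    simp only [Fin.val_castSucc] at h1 h2
    exact ⟨trivial, trivial, Subtype.ext (Fin.ext (by dsimp only; omega))⟩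
  · have : k = l := congrArg Subtype.val h
    subst this
    exact ⟨hcar k, hcar k, (ofGaps _ hB).rel.refl _⟩

end Path

end Correspondence

end Arboreal

namespace Arboreal

/-! ### The one-sided unfolding of a sequence and its inverse by running minima -/

section Fold

/-- `w_i⁺ + ∑_{i < j ≤ a} w_j⁻`. -/
noncomputable def fold (w : ℕ → ℝ) (a i : ℕ) : ℝ :=
  max (w i) 0 + ∑ j ∈ Finset.Ioc i a, max (-w j) 0

/-- The minimum of `y_0, …, y_i`. -/
noncomputable def runmin (y : ℕ → ℝ) : ℕ → ℝ
  | 0 => y 0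
  | i + 1 => min (runmin y i) (y (i + 1))

theorem le_runmin_iff {y : ℕ → ℝ} {a : ℕ} {c : ℝ} : c ≤ runmin y a ↔ ∀ i ≤ a, c ≤ y i := by
  induction a with
  | zero => exact ⟨fun h i hi => by obtain rfl : i = 0 := by omega
                                    exact h, fun h => h 0 le_rfl⟩
  | succ a ih =>
    rw [runmin, le_min_iff, ih]
    refine ⟨fun ⟨h1, h2⟩ i hi => ?_, fun h => ⟨fun i hi => h i (by omega), h _ le_rfl⟩⟩
    rcases Nat.of_le_succ hi with hi | rfl
    exacts [h1 i hi, h2]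

theorem runmin_le_iff {y : ℕ → ℝ} {a : ℕ} {c : ℝ} : runmin y a ≤ c ↔ ∃ i ≤ a, y i ≤ c := by
  induction a with
  | zero => exact ⟨fun h => ⟨0, le_rfl, h⟩, fun ⟨i, hi, h⟩ => by
      obtain rfl : i = 0 := by omega
      exact h⟩
  | succ a ih =>
    rw [runmin, min_le_iff, ih]
    constructor
    · rintro (⟨i, hi, h⟩ | h)
      exacts [⟨i, by omega, h⟩, ⟨_, le_rfl, h⟩]
    · rintro ⟨i, hi, h⟩
      rcases Nat.of_le_succ hi with hi | rfl
      exacts [Or.inl ⟨i, hi, h⟩, Or.inr h]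

theorem runmin_congr {y y' : ℕ → ℝ} {a : ℕ} (h : ∀ i ≤ a, y i = y' i) :
    runmin y a = runmin y' a := by
  induction a with
  | zero => exact h 0 le_rfl
  | succ a ih => rw [runmin, runmin, ih fun i hi => h i (by omega), h _ le_rfl]

theorem runmin_eq_zero {y : ℕ → ℝ} {a : ℕ} (h0 : ∀ i ≤ a, 0 ≤ y i) (h : ∃ i ≤ a, y i = 0) :
    runmin y a = 0 := by
  obtain ⟨i, hi, h⟩ := h
  exact le_antisymm (runmin_le_iff.mpr ⟨i, hi, h.le⟩) (le_runmin_iff.mpr h0)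

theorem exists_eq_zero_of_runmin {y : ℕ → ℝ} {a : ℕ} (h : runmin y a = 0) :
    ∃ i ≤ a, y i = 0 := by
  obtain ⟨i, hi, h'⟩ := runmin_le_iff.mp h.le
  exact ⟨i, hi, le_antisymm h' (le_runmin_iff.mp h.ge i hi)⟩

theorem continuous_runmin {X : Type*} [TopologicalSpace X] {f : X → ℕ → ℝ}
    (hf : ∀ i, Continuous fun x => f x i) (a : ℕ) : Continuous fun x => runmin (f x) a := by
  induction a with
  | zero => exact hf 0
  | succ a ih => exact ih.min (hf _)

theorem fold_nonneg (w : ℕ → ℝ) (a i : ℕ) : 0 ≤ fold w a i :=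
  add_nonneg (le_max_right _ _) (Finset.sum_nonneg fun _ _ => le_max_right _ _)

/-- A nonnegative weight has no negative part. This makes the unfolding insensitive to moving the
base vertex across a glued edge. -/
theorem fold_succ {w : ℕ → ℝ} {a i : ℕ} (hi : i ≤ a) (hw : 0 ≤ w (a + 1)) :
    fold w (a + 1) i = fold w a i := by
  rw [fold, fold, ← Finset.insert_Ioc_right_eq_Ioc_add_one hi, Finset.sum_insert (by simp),
    max_eq_right (neg_nonpos.mpr hw), zero_add]

theorem fold_self (w : ℕ → ℝ) (a : ℕ) : fold w a a = max (w a) 0 := by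
  simp [fold]

theorem fold_smul (w : ℕ → ℝ) (a i : ℕ) {r : ℝ} (hr : 0 ≤ r) :
    fold (fun j => r * w j) a i = r * fold w a i := by
  have h : ∀ x : ℝ, max (r * x) 0 = r * max x 0 := fun x => by
    rw [mul_max_of_nonneg _ _ hr, mul_zero]
  simp only [fold, mul_add, Finset.mul_sum, ← mul_neg, h]

theorem continuous_fold {X : Type*} [TopologicalSpace X] {f : X → ℕ → ℝ}
    (hf : ∀ i, Continuous fun x => f x i) (a i : ℕ) : Continuous fun x => fold (f x) a i :=
  ((hf i).max continuous_const).add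
    (continuous_finsetSum _ fun j _ => (hf j).neg.max continuous_const)

theorem Ioc_sum_eq (f : ℕ → ℝ) {a i : ℕ} (hi : i < a) :
    ∑ j ∈ Finset.Ioc i a, f j = f (i + 1) + ∑ j ∈ Finset.Ioc (i + 1) a, f j := by
  rw [← Finset.insert_Ioc_add_one_left_eq_Ioc hi, Finset.sum_insert (by simp)]

/-- Past the common tail, each step compares `w⁻` with `w⁺`, one of which is zero. The normalization
`w 0 = 0` starts the induction. -/
theorem runmin_fold {w : ℕ → ℝ} (h0 : w 0 = 0) {a i : ℕ} (hi : i ≤ a) :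
    runmin (fold w a) i = ∑ j ∈ Finset.Ioc i a, max (-w j) 0 := by
  induction i with
  | zero => simp [runmin, fold, h0]
  | succ i ih =>
    rw [runmin, ih (by omega), Ioc_sum_eq _ hi, fold, min_add_add_right]
    rcases le_total (w (i + 1)) 0 with h | h
    · rw [max_eq_left (by linarith), max_eq_right h, min_eq_right (by linarith), zero_add]
    · rw [max_eq_right (by linarith), max_eq_left h, min_eq_left h, zero_add]

theorem exists_fold_eq_zero {w : ℕ → ℝ} (h0 : w 0 = 0) (a : ℕ) : ∃ i ≤ a, fold w a i = 0 :=
  exists_eq_zero_of_runmin (by rw [runmin_fold h0 le_rfl]; simp)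

/-- The tails cancel and `w⁺ - w⁻ = w` remains. -/
theorem fold_sub_runmin {w : ℕ → ℝ} (h0 : w 0 = 0) {a i : ℕ} (hi : i < a) :
    fold w a (i + 1) - runmin (fold w a) i = w (i + 1) := by
  rw [runmin_fold h0 hi.le, fold, Ioc_sum_eq _ hi]
  rcases le_total (w (i + 1)) 0 with h | h
  · rw [max_eq_left (by linarith : 0 ≤ -w (i + 1)), max_eq_right h]; ring
  · rw [max_eq_right (by linarith : -w (i + 1) ≤ 0), max_eq_left h]; ring

/-- If `w_0 = 0` and `w_i = y_i - min (y_0, …, y_{i-1})` then `y` is recovered from `w`. -/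
theorem fold_eq_of_runmin {w y : ℕ → ℝ} {a i : ℕ} (hi : i ≤ a) (h0 : w 0 = 0)
    (hw : ∀ i < a, w (i + 1) = y (i + 1) - runmin y i) (ha : runmin y a = 0) :
    fold w a i = y i := by
  -- Each negative part is the drop of the running minimum at that step. The sum telescopes down
  -- from `a`, where the minimum is zero by `ha`.
  have key : ∀ d i, i + d = a → ∑ j ∈ Finset.Ioc i a, max (-w j) 0 = runmin y i := by
    intro d
    induction d with
    | zero => rintro i rfl; simpa using ha.symm
    | succ d ih =>
      intro i hid
      rw [Ioc_sum_eq _ (by omega), ih (i + 1) (by omega), hw i (by omega), runmin]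
      rcases le_total (runmin y i) (y (i + 1)) with h | h
      · rw [max_eq_right (by linarith), min_eq_left h]; ring
      · rw [max_eq_left (by linarith), min_eq_right h]; ring
  rw [fold, key (a - i) i (by omega)]
  cases i with
  | zero => simp [h0, runmin]
  | succ i =>
    rw [hw i (by omega), runmin]
    rcases le_total (runmin y i) (y (i + 1)) with h | h
    · rw [max_eq_left (by linarith), min_eq_left h]; ring
    · rw [max_eq_right (by linarith), min_eq_right h]; ring

end Fold

/-! ### Unfolding and refolding a single chart -/

section Unfolding

variable {n : ℕ}

/-- The coordinates of a chart, extended by zero. -/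
noncomputable def coord (a : Fin n) (x : Chart (Fin n) a) (k : ℕ) : ℝ :=
  if h : k < n then (if h' : (⟨k, h⟩ : Fin n) ≠ a then x ⟨⟨k, h⟩, h'⟩ else 0) else 0

theorem coord_of_ne {a : Fin n} (x : Chart (Fin n) a) {k : Fin n} (h : k ≠ a) :
    coord a x k = x ⟨k, h⟩ := by
  simp [coord, h]

theorem coord_of_le {a : Fin n} (x : Chart (Fin n) a) {k : ℕ} (h : n ≤ k) : coord a x k = 0 :=
  dif_neg (by omega)

theorem continuous_coord (a : Fin n) (k : ℕ) : Continuous fun x => coord a x k := by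
  unfold coord
  split_ifs <;> fun_prop

theorem coord_smul (a : Fin n) (r : ℝ) (x : Chart (Fin n) a) (k : ℕ) :
    coord a (r • x) k = r * coord a x k := by
  unfold coord
  split_ifs <;> simp

/-- The coordinate of a chart at the edge between the vertices `i - 1` and `i`. -/
noncomputable def weight (a : Fin n) (x : Chart (Fin n) a) (i : ℕ) : ℝ :=
  if i ≤ a then (if i = 0 then 0 else coord a x (i - 1)) else coord a x i

theorem weight_zero (a : Fin n) (x : Chart (Fin n) a) : weight a x 0 = 0 := by
  simp [weight]

theorem weight_of_le (a : Fin n) (x : Chart (Fin n) a) {i : ℕ} (h : n ≤ i) : weight a x i = 0 := by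
  rw [weight, if_neg (by omega), coord_of_le x h]

theorem weight_succ {a : Fin n} (x : Chart (Fin n) a) {i : ℕ} (h : i < a) :
    weight a x (i + 1) = coord a x i := by
  rw [weight, if_pos (by omega), if_neg (by omega), Nat.add_sub_cancel]

theorem weight_of_lt {a : Fin n} (x : Chart (Fin n) a) {i : ℕ} (h : a < i) :
    weight a x i = coord a x i := if_neg (by omega)

theorem continuous_weight (a : Fin n) (k : ℕ) : Continuous fun x => weight a x k := by
  unfold weight
  split_ifs
  exacts [continuous_const, continuous_coord _ _, continuous_coord _ _]

theorem weight_smul (a : Fin n) (r : ℝ) (x : Chart (Fin n) a) (k : ℕ) :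
    weight a (r • x) k = r * weight a x k := by
  unfold weight
  split_ifs <;> simp [coord_smul]

/-- The unfolding of a chart: at a gap `i` to the left of the vertex `a` it is
`w_i⁺ + ∑_{i < j ≤ a} w_j⁻`, and symmetrically on the right. -/
noncomputable def chartUnfold (a : Fin n) (x : Chart (Fin n) a) (i : Fin (n + 1)) : ℝ :=
  if i.1 ≤ a then fold (weight a x) a i else fold (fun j => weight a x (n - j)) (n - a - 1) (n - i)

theorem chartUnfold_nonneg (a : Fin n) (x : Chart (Fin n) a) (i : Fin (n + 1)) :
    0 ≤ chartUnfold a x i := by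
  unfold chartUnfold
  split_ifs <;> exact fold_nonneg _ _ _

theorem continuous_chartUnfold (a : Fin n) : Continuous (chartUnfold a) := by
  refine continuous_pi fun i => ?_
  unfold chartUnfold
  split_ifs
  exacts [continuous_fold (fun j => continuous_weight a j) _ _,
    continuous_fold (fun j => continuous_weight a (n - j)) _ _]

theorem chartUnfold_smul (a : Fin n) {r : ℝ} (hr : 0 ≤ r) (x : Chart (Fin n) a) :
    chartUnfold a (r • x) = r • chartUnfold a x := by
  ext i
  simp only [chartUnfold, Pi.smul_apply, smul_eq_mul]
  split_ifs
  · rw [← fold_smul _ _ _ hr]; congr 1; ext j; exact weight_smul _ _ _ _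
  · rw [← fold_smul _ _ _ hr]; congr 1; ext j; exact weight_smul _ _ _ _

theorem exists_chartUnfold_eq_zero_left (a : Fin n) (x : Chart (Fin n) a) :
    ∃ i : Fin (n + 1), i.1 ≤ a ∧ chartUnfold a x i = 0 := by
  obtain ⟨i, hi, h⟩ := exists_fold_eq_zero (weight_zero a x) a
  exact ⟨⟨i, by omega⟩, hi, by rw [chartUnfold, if_pos hi]; exact h⟩

theorem exists_chartUnfold_eq_zero_right (a : Fin n) (x : Chart (Fin n) a) :
    ∃ i : Fin (n + 1), a.1 < i ∧ chartUnfold a x i = 0 := by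
  -- The reversal `i ↦ n - i` carries the gaps `a + 1, …, n` to `n - a - 1, …, 0`, starting at the
  -- gap `n` of weight zero.
  obtain ⟨i, hi, h⟩ := exists_fold_eq_zero (w := fun j => weight a x (n - j))
    (weight_of_le a x (by omega)) (n - a - 1)
  refine ⟨⟨n - i, by omega⟩, by dsimp only; omega, ?_⟩
  rw [chartUnfold, if_neg (by dsimp only; omega)]
  simpa only [show n - (n - i) = i by omega] using h

/-- The glued coordinate sits at the gap `b` in both charts, so the weights coincide. Only the range
of the sums changes, by the gap `b`, whose weight is nonnegative. -/
theorem chartUnfold_eq_of_succ {a b : Fin n} (hab : a.1 + 1 = b) {x : Chart (Fin n) a}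
    {y : Chart (Fin n) b} (h1 : coord a x b = coord b y a) (h2 : 0 ≤ coord a x b)
    (h3 : ∀ k, k ≠ a.1 → k ≠ b → coord a x k = coord b y k) :
    chartUnfold a x = chartUnfold b y := by
  have hw : weight a x = weight b y := by
    ext i
    unfold weight
    rcases lt_trichotomy i b.1 with h | h | h
    · rw [if_pos (show i ≤ a.1 by omega), if_pos (show i ≤ b.1 by omega)]
      split_ifs
      · rfl
      · exact h3 _ (by omega) (by omega)
    · subst h
      rw [if_neg (by omega), if_pos le_rfl, if_neg (by omega), h1]
      congr 1; omega
    · rw [if_neg (by omega), if_neg (by omega), h3 i (by omega) (by omega)]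
  have hb : 0 ≤ weight b y b := by rw [← hw, weight_of_lt x (by omega)]; exact h2
  ext i
  unfold chartUnfold
  rw [hw]
  rcases lt_trichotomy i.1 b.1 with h | h | h
  · rw [if_pos (by omega), if_pos (by omega), ← hab, fold_succ (by omega) (by rw [hab]; exact hb)]
  -- The gap `b` is the first one to the right of `a` and the first one to the left of `b`: both
  -- sums are empty.
  · rw [if_neg (by omega), if_pos (by omega), h, fold_self, show n - a.1 - 1 = n - b.1 by omega,
      fold_self, show n - (n - b.1) = b.1 by omega]
  · rw [if_neg (by omega), if_neg (by omega), show n - a.1 - 1 = (n - b.1 - 1) + 1 by omega,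
      fold_succ (by omega) (by rw [show n - (n - b.1 - 1 + 1) = b.1 by omega]; exact hb)]

theorem chartUnfold_eq_of_edgeGlue {x y : Σ a : Fin n, Chart (Fin n) a}
    (h : EdgeGlue (anTree n) x y) : chartUnfold x.1 x.2 = chartUnfold y.1 y.2 := by
  obtain ⟨hadj, h1, h2, h3⟩ := h
  have h1' : coord x.1 x.2 y.1 = coord y.1 y.2 x.1 := by
    rw [coord_of_ne _ hadj.ne', coord_of_ne _ hadj.ne, h1]
  have h2' : 0 ≤ coord x.1 x.2 y.1 := by rw [coord_of_ne _ hadj.ne']; exact h2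
  have h3' : ∀ k, k ≠ x.1.1 → k ≠ y.1.1 → coord x.1 x.2 k = coord y.1 y.2 k := by
    intro k hx hy
    by_cases hk : k < n
    · have e := h3 ⟨k, hk⟩ (fun h => hx (congrArg Fin.val h)) (fun h => hy (congrArg Fin.val h))
      rw [← coord_of_ne, ← coord_of_ne] at e
      exact e
    · rw [coord_of_le _ (by omega), coord_of_le _ (by omega)]
  rcases Correspondence.anTree_adj.mp hadj with h | h
  · exact chartUnfold_eq_of_succ h h1' h2' h3'
  · exact (chartUnfold_eq_of_succ h h1'.symm (h1' ▸ h2') fun k hy hx => (h3' k hx hy).symm).symm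

/-- The value of a function on the gaps, extended by zero. -/
noncomputable def gapValue (y : Fin (n + 1) → ℝ) (i : ℕ) : ℝ :=
  if h : i < n + 1 then y ⟨i, h⟩ else 0

theorem gapValue_val (y : Fin (n + 1) → ℝ) (i : Fin (n + 1)) : gapValue y i = y i :=
  dif_pos i.2

theorem gapValue_nonneg {y : Fin (n + 1) → ℝ} (h : ∀ i, 0 ≤ y i) (i : ℕ) : 0 ≤ gapValue y i := by
  unfold gapValue
  split_ifs
  exacts [h _, le_rfl]

theorem continuous_gapValue (i : ℕ) : Continuous fun y : Fin (n + 1) → ℝ => gapValue y i := by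
  unfold gapValue
  split_ifs <;> fun_prop

/-- The inverse of `chartUnfold`. -/
noncomputable def chartFold (a : Fin n) (y : Fin (n + 1) → ℝ) : Chart (Fin n) a :=
  WithLp.toLp 2 fun k => if k.1 < a
    then gapValue y (k.1 + 1) - runmin (gapValue y) k.1
    else gapValue y k.1 - runmin (fun j => gapValue y (n - j)) (n - k.1 - 1)

theorem continuous_chartFold (a : Fin n) : Continuous (chartFold a) := by
  refine (PiLp.continuous_toLp 2 _).comp (continuous_pi fun k => ?_)
  split_ifs
  exacts [(continuous_gapValue _).sub (continuous_runmin continuous_gapValue _),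
    (continuous_gapValue _).sub (continuous_runmin (fun j => continuous_gapValue (n - j)) _)]

theorem coord_chartFold_of_lt {a : Fin n} (y : Fin (n + 1) → ℝ) {k : ℕ} (h : k < a) :
    coord a (chartFold a y) k = gapValue y (k + 1) - runmin (gapValue y) k := by
  have e : (⟨k, by omega⟩ : Fin n) ≠ a := fun e => by have := congrArg Fin.val e; dsimp at this; omega
  have := coord_of_ne (chartFold a y) e
  dsimp only at this
  rw [this]
  exact if_pos (Fin.lt_def.mpr h)

theorem coord_chartFold_of_gt {a : Fin n} (y : Fin (n + 1) → ℝ) {k : ℕ} (h : a < k) (hk : k < n) :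
    coord a (chartFold a y) k =
      gapValue y k - runmin (fun j => gapValue y (n - j)) (n - k - 1) := by
  have e : (⟨k, hk⟩ : Fin n) ≠ a := fun e => by have := congrArg Fin.val e; dsimp at this; omega
  have := coord_of_ne (chartFold a y) e
  dsimp only at this
  rw [this]
  exact if_neg (fun h' => by have := Fin.lt_def.mp h'; dsimp at this; omega)

theorem chart_ext {a : Fin n} {x y : Chart (Fin n) a}
    (h : ∀ k : ℕ, k < n → k ≠ a → coord a x k = coord a y k) : x = y := by
  ext ⟨k, hk⟩
  have := h k k.2 (fun h => hk (Fin.ext h))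
  rwa [coord_of_ne x hk, coord_of_ne y hk] at this

theorem chartFold_chartUnfold (a : Fin n) (x : Chart (Fin n) a) :
    chartFold a (chartUnfold a x) = x := by
  have hl : ∀ i : ℕ, i ≤ a → gapValue (chartUnfold a x) i = fold (weight a x) a i := by
    intro i hi
    rw [gapValue, dif_pos (by omega), chartUnfold, if_pos hi]
  have hr : ∀ i : ℕ, i ≤ n - a - 1 → gapValue (chartUnfold a x) (n - i) =
      fold (fun j => weight a x (n - j)) (n - a - 1) i := by
    intro i hi
    rw [gapValue, dif_pos (by omega), chartUnfold, if_neg (by dsimp only; omega)]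
    congr 1; dsimp only; omega
  refine chart_ext fun k hk hka => ?_
  rcases lt_or_gt_of_ne hka with h | h
  · rw [coord_chartFold_of_lt _ h, hl _ (by omega), runmin_congr fun i hi => hl i (by omega),
      fold_sub_runmin (weight_zero a x) h, weight_succ x h]
  · rw [coord_chartFold_of_gt _ h hk, runmin_congr fun i hi => hr i (by omega)]
    have e := hr (n - k) (by omega)
    rw [show n - (n - k) = k by omega] at e
    rw [e]
    have e' := fold_sub_runmin (w := fun j => weight a x (n - j)) (weight_of_le a x (by omega))
      (show n - k - 1 < n - a - 1 by omega)
    rw [show n - k - 1 + 1 = n - k by omega] at e'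
    rw [e', show n - (n - k) = k by omega, weight_of_lt x h]

/-- A zero on each side makes the minimum over that side vanish, which is the normalization required
by `fold_eq_of_runmin`. -/
theorem chartUnfold_chartFold (a : Fin n) {y : Fin (n + 1) → ℝ} (h0 : ∀ i, 0 ≤ y i)
    (hl : ∃ i : Fin (n + 1), i.1 ≤ a ∧ y i = 0) (hr : ∃ i : Fin (n + 1), a.1 < i ∧ y i = 0) :
    chartUnfold a (chartFold a y) = y := by
  ext i
  unfold chartUnfold
  split_ifs with hi
  · rw [fold_eq_of_runmin hi (weight_zero _ _) (y := gapValue y) _ _, gapValue_val]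
    · intro j hj
      rw [weight_succ _ hj, coord_chartFold_of_lt _ hj]
    · obtain ⟨j, hj, h⟩ := hl
      exact runmin_eq_zero (fun _ _ => gapValue_nonneg h0 _) ⟨j, hj, by rw [gapValue_val, h]⟩
  · rw [fold_eq_of_runmin (w := fun j => weight a (chartFold a y) (n - j)) (by omega)
      (weight_of_le _ _ (by omega)) (y := fun j => gapValue y (n - j)) _ _]
    · rw [show n - (n - i.1) = i.1 by omega, gapValue_val]
    · intro j hj
      rw [weight_of_lt _ (by omega), coord_chartFold_of_gt _ (by omega) (by omega)]
      congr 2; omega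
    · obtain ⟨j, hj, h⟩ := hr
      refine runmin_eq_zero (fun _ _ => gapValue_nonneg h0 _) ⟨n - j, by omega, ?_⟩
      rw [show n - (n - j.1) = j.1 by omega, gapValue_val, h]

/-- At an edge inside the subtree the coordinate is the value of the unfolding at its gap. -/
theorem coord_chartFold_succ {a b : Fin n} (hab : a.1 + 1 = b) {y : Fin (n + 1) → ℝ}
    (h0 : ∀ i, 0 ≤ y i) (hr : ∃ i : Fin (n + 1), b.1 < i ∧ y i = 0) :
    coord a (chartFold a y) b = gapValue y b := by
  rw [coord_chartFold_of_gt _ (by omega) b.2, runmin_eq_zero, sub_zero]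
  · exact fun _ _ => gapValue_nonneg h0 _
  · obtain ⟨j, hj, h⟩ := hr
    refine ⟨n - j, by omega, ?_⟩
    rw [show n - (n - j.1) = j.1 by omega, gapValue_val, h]

theorem coord_chartFold_pred {a b : Fin n} (hab : a.1 + 1 = b) {y : Fin (n + 1) → ℝ}
    (h0 : ∀ i, 0 ≤ y i) (hl : ∃ i : Fin (n + 1), i.1 ≤ a ∧ y i = 0) :
    coord b (chartFold b y) a = gapValue y b := by
  rw [coord_chartFold_of_lt _ (by omega), runmin_eq_zero, sub_zero, hab]
  · exact fun _ _ => gapValue_nonneg h0 _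
  · obtain ⟨j, hj, h⟩ := hl
    exact ⟨j, hj, by rw [gapValue_val, h]⟩

/-- The outer zeros kill the running minima at the gap `b`, so both glued coordinates equal `y_b ≥
0`. Every other vertex lies on the same side of `a` and of `b`, where the formulas agree. -/
theorem mk_chartFold_succ {a b : Fin n} (hab : a.1 + 1 = b) {y : Fin (n + 1) → ℝ}
    (h0 : ∀ i, 0 ≤ y i) (hl : ∃ i : Fin (n + 1), i.1 ≤ a ∧ y i = 0)
    (hr : ∃ i : Fin (n + 1), b.1 < i ∧ y i = 0) :
    Singularity.mk (anTree n) a (chartFold a y) = Singularity.mk (anTree n) b (chartFold b y) := by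
  have hadj : (anTree n).Adj a b := Correspondence.anTree_adj.mpr (Or.inl hab)
  refine Quot.sound ⟨hadj, ?_, ?_, ?_⟩
  · dsimp only
    rw [← coord_of_ne, ← coord_of_ne, coord_chartFold_succ hab h0 hr,
      coord_chartFold_pred hab h0 hl]
  · dsimp only
    rw [← coord_of_ne, coord_chartFold_succ hab h0 hr]
    exact gapValue_nonneg h0 _
  · intro k hka hkb
    dsimp only at hka hkb ⊢
    rw [← coord_of_ne, ← coord_of_ne]
    have h1 : k.1 ≠ a.1 := fun h => hka (Fin.ext h)
    have h2 : k.1 ≠ b.1 := fun h => hkb (Fin.ext h)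
    rcases lt_or_gt_of_ne h1 with h | h
    · rw [coord_chartFold_of_lt _ h, coord_chartFold_of_lt _ (by omega)]
    · rw [coord_chartFold_of_gt _ h k.2, coord_chartFold_of_gt _ (by omega) k.2]

/-- Move one edge at a time: the left zero of the smaller vertex and the right zero of the larger
one serve all vertices in between. -/
theorem mk_chartFold_eq {a b : Fin n} {y : Fin (n + 1) → ℝ} (h0 : ∀ i, 0 ≤ y i)
    (hla : ∃ i : Fin (n + 1), i.1 ≤ a ∧ y i = 0) (hra : ∃ i : Fin (n + 1), a.1 < i ∧ y i = 0)
    (hlb : ∃ i : Fin (n + 1), i.1 ≤ b ∧ y i = 0) (hrb : ∃ i : Fin (n + 1), b.1 < i ∧ y i = 0) :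
    Singularity.mk (anTree n) a (chartFold a y) = Singularity.mk (anTree n) b (chartFold b y) := by
  have key : ∀ d (a b : Fin n), a.1 + d = b →
      (∃ i : Fin (n + 1), i.1 ≤ a ∧ y i = 0) → (∃ i : Fin (n + 1), b.1 < i ∧ y i = 0) →
      Singularity.mk (anTree n) a (chartFold a y) =
        Singularity.mk (anTree n) b (chartFold b y) := by
    intro d
    induction d with
    | zero =>
      intro a b h _ _
      obtain rfl : a = b := Fin.ext h
      rfl
    | succ d ih =>
      intro a b h hl hr
      have h1 : (⟨a.1 + d, by omega⟩ : Fin n).1 + 1 = b := by dsimp only; omega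
      obtain ⟨i, hi, hi'⟩ := hl
      obtain ⟨j, hj, hj'⟩ := hr
      rw [ih a ⟨a.1 + d, by omega⟩ rfl ⟨i, hi, hi'⟩ ⟨j, by dsimp only; omega, hj'⟩]
      exact mk_chartFold_succ h1 h0 ⟨i, by dsimp only; omega, hi'⟩ ⟨j, hj, hj'⟩
  rcases le_total a.1 b.1 with h | h
  · exact key (b.1 - a.1) a b (by omega) hla hrb
  · exact (key (a.1 - b.1) b a (by omega) hlb hra).symm

end Unfolding

end Arboreal

namespace Arboreal

/-! ### Dilation, the norm and compactness of the link -/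

section Radius

namespace Singularity

variable {V : Type*} {G : SimpleGraph V}

theorem exists_mk (x : Singularity G) : ∃ α y, mk G α y = x := by
  obtain ⟨⟨α, y⟩, rfl⟩ := Quot.exists_rep x
  exact ⟨α, y, rfl⟩

theorem continuous_mk (α : V) : Continuous (mk G α) :=
  continuous_quot_mk.comp continuous_sigmaMk

theorem dilate_mk (r : ℝ≥0) (α : V) (y : Chart V α) :
    dilate r (mk G α y) = mk G α ((r : ℝ) • y) := rfl

theorem dilate_dilate (r s : ℝ≥0) (x : Singularity G) :
    dilate r (dilate s x) = dilate (r * s) x := by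
  obtain ⟨α, y, rfl⟩ := exists_mk x
  rw [dilate_mk, dilate_mk, dilate_mk, smul_smul, NNReal.coe_mul]

theorem dilate_one (x : Singularity G) : dilate 1 x = x := by
  obtain ⟨α, y, rfl⟩ := exists_mk x
  rw [dilate_mk, NNReal.coe_one, one_smul]

theorem dilate_dilate_inv {r : ℝ≥0} (hr : r ≠ 0) (x : Singularity G) :
    dilate r (dilate r⁻¹ x) = x := by
  rw [dilate_dilate, mul_inv_cancel₀ hr, dilate_one]

end Singularity

variable {V : Type*} [Fintype V] [DecidableEq V] {G : SimpleGraph V}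

/-- Swapping the two endpoints of the edge matches the coordinates of the two charts. -/
theorem nnnorm_eq_of_edgeGlue {x y : Σ α : V, Chart V α} (h : EdgeGlue G x y) :
    ‖x.2‖₊ = ‖y.2‖₊ := by
  obtain ⟨hadj, h1, -, h3⟩ := h
  let e : {γ : V // γ ≠ x.1} ≃ {γ : V // γ ≠ y.1} :=
    (Equiv.swap x.1 y.1).subtypeEquiv fun γ => by
      rw [not_iff_not, Equiv.swap_apply_eq_iff, Equiv.swap_apply_right]
  rw [EuclideanSpace.nnnorm_eq, EuclideanSpace.nnnorm_eq, ← e.sum_comp]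
  congr 1
  refine Finset.sum_congr rfl fun γ _ => ?_
  obtain ⟨γ, hγ⟩ := γ
  by_cases hy : γ = y.1
  · subst hy
    have : e ⟨y.1, hγ⟩ = ⟨x.1, hadj.ne⟩ := Subtype.ext (Equiv.swap_apply_right _ _)
    rw [this, h1]
  · have : e ⟨γ, hγ⟩ = ⟨γ, hy⟩ := Subtype.ext (Equiv.swap_apply_of_ne_of_ne hγ hy)
    rw [this, h3 γ hγ hy]

namespace Singularity

/-- The distance to the central point. -/
noncomputable def radius : Singularity G → ℝ≥0 :=
  Quot.lift (fun x => ‖x.2‖₊) fun _ _ => nnnorm_eq_of_edgeGlue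

theorem radius_mk (α : V) (y : Chart V α) : radius (mk G α y) = ‖y‖₊ := rfl

theorem continuous_radius : Continuous (radius (G := G)) :=
  continuous_quot_lift _ (continuous_sigma fun _ => continuous_nnnorm)

theorem radius_dilate (r : ℝ≥0) (x : Singularity G) : radius (dilate r x) = r * radius x := by
  obtain ⟨α, y, rfl⟩ := exists_mk x
  rw [dilate_mk, radius_mk, radius_mk, nnnorm_smul, NNReal.nnnorm_eq]

theorem mem_link_iff {x : Singularity G} : x ∈ link G ↔ radius x = 1 := by
  constructor
  · rintro ⟨α, y, hy, rfl⟩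
    exact NNReal.eq hy
  · obtain ⟨α, y, rfl⟩ := exists_mk x
    exact fun h => ⟨α, y, congrArg NNReal.toReal h, rfl⟩

end Singularity

instance : CompactSpace (link G) := by
  have : link G = ⋃ α, Singularity.mk G α '' Metric.sphere 0 1 := by
    ext x
    simp [link]
  rw [← isCompact_iff_compactSpace, this]
  exact isCompact_iUnion fun α => (isCompact_sphere 0 1).image (Singularity.continuous_mk α)

end Radius

/-! ### The singularity as a fan in `ℝ^(n+1)` -/

section Unfold

variable {n : ℕ}

/-- The nonnegative vectors with at least two vanishing coordinates. -/
def doublyVanishing (n : ℕ) : Set (Fin (n + 1) → ℝ) :=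
  {y | (∀ i, 0 ≤ y i) ∧ ∃ i j, i < j ∧ y i = 0 ∧ y j = 0}

namespace Singularity

/-- The unfolding of the singularity of `A_n` in `ℝ^(n+1)`. -/
noncomputable def unfold : Singularity (anTree n) → Fin (n + 1) → ℝ :=
  Quot.lift (fun x => chartUnfold x.1 x.2) fun _ _ => chartUnfold_eq_of_edgeGlue

theorem unfold_mk (a : Fin n) (x : Chart (Fin n) a) :
    unfold (mk (anTree n) a x) = chartUnfold a x := rfl

theorem continuous_unfold : Continuous (unfold (n := n)) :=
  continuous_quot_lift _ (continuous_sigma fun a => continuous_chartUnfold a)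

theorem unfold_nonneg (x : Singularity (anTree n)) (i : Fin (n + 1)) : 0 ≤ unfold x i := by
  obtain ⟨a, y, rfl⟩ := exists_mk x
  exact chartUnfold_nonneg a y i

theorem unfold_mem (x : Singularity (anTree n)) : unfold x ∈ doublyVanishing n := by
  refine ⟨unfold_nonneg x, ?_⟩
  obtain ⟨a, y, rfl⟩ := exists_mk x
  obtain ⟨i, hi, h⟩ := exists_chartUnfold_eq_zero_left a y
  obtain ⟨j, hj, h'⟩ := exists_chartUnfold_eq_zero_right a y
  exact ⟨i, j, Fin.lt_def.mpr (by omega), h, h'⟩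

theorem unfold_dilate (r : ℝ≥0) (x : Singularity (anTree n)) :
    unfold (dilate r x) = (r : ℝ) • unfold x := by
  obtain ⟨a, y, rfl⟩ := exists_mk x
  exact chartUnfold_smul a r.2 y

/-- A point can be recovered from its unfolding in any chart with zeros on both sides, not only in
the chart it came from. Injectivity and `inChart_iff` both rest on this. -/
theorem mk_chartFold_unfold {x : Singularity (anTree n)} {b : Fin n}
    (hl : ∃ i : Fin (n + 1), i.1 ≤ b ∧ unfold x i = 0)
    (hr : ∃ i : Fin (n + 1), b.1 < i ∧ unfold x i = 0) :
    mk (anTree n) b (chartFold b (unfold x)) = x := by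
  obtain ⟨a, y, rfl⟩ := exists_mk x
  rw [← mk_chartFold_eq (unfold_nonneg _) (exists_chartUnfold_eq_zero_left a y)
    (exists_chartUnfold_eq_zero_right a y) hl hr, unfold_mk, chartFold_chartUnfold]

theorem unfold_injective : Function.Injective (unfold (n := n)) := by
  intro x x' h
  obtain ⟨a, y, rfl⟩ := exists_mk x
  have hl := exists_chartUnfold_eq_zero_left a y
  have hr := exists_chartUnfold_eq_zero_right a y
  rw [← unfold_mk] at hl hr
  rw [← mk_chartFold_unfold hl hr, h]
  rw [h] at hl hr
  exact mk_chartFold_unfold hl hr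

theorem inChart_iff {x : Singularity (anTree n)} {a : Fin n} :
    x.InChart a ↔ (∃ i : Fin (n + 1), i.1 ≤ a ∧ unfold x i = 0) ∧
      ∃ i : Fin (n + 1), a.1 < i ∧ unfold x i = 0 := by
  constructor
  · rintro ⟨y, rfl⟩
    exact ⟨exists_chartUnfold_eq_zero_left a y, exists_chartUnfold_eq_zero_right a y⟩
  · rintro ⟨hl, hr⟩
    exact ⟨_, mk_chartFold_unfold hl hr⟩

theorem posEdge_iff_of_succ {x : Singularity (anTree n)} {a b : Fin n} (hab : a.1 + 1 = b) :
    x.PosEdge a b ↔ x.InChart a ∧ x.InChart b ∧ 0 < unfold x b.castSucc := by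
  have hadj : (anTree n).Adj a b := Correspondence.anTree_adj.mpr (Or.inl hab)
  have e : gapValue (unfold x) b = unfold x b.castSucc := gapValue_val _ b.castSucc
  constructor
  · rintro ⟨h, ha, hb, y, rfl, hy⟩
    refine ⟨ha, hb, ?_⟩
    rwa [← coord_of_ne, ← chartFold_chartUnfold a y,
      coord_chartFold_succ hab (chartUnfold_nonneg a y) (inChart_iff.mp hb).2, ← unfold_mk, e] at hy
  · rintro ⟨ha, hb, h⟩
    have ha' := inChart_iff.mp ha
    refine ⟨hadj, ha, hb, _, mk_chartFold_unfold ha'.1 ha'.2, ?_⟩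
    rwa [← coord_of_ne, coord_chartFold_succ hab (unfold_nonneg x) (inChart_iff.mp hb).2, e]

theorem posEdge_iff_of_pred {x : Singularity (anTree n)} {a b : Fin n} (hab : a.1 + 1 = b) :
    x.PosEdge b a ↔ x.InChart a ∧ x.InChart b ∧ 0 < unfold x b.castSucc := by
  have hadj : (anTree n).Adj b a := Correspondence.anTree_adj.mpr (Or.inr hab)
  have e : gapValue (unfold x) b = unfold x b.castSucc := gapValue_val _ b.castSucc
  constructor
  · rintro ⟨h, hb, ha, y, rfl, hy⟩
    refine ⟨ha, hb, ?_⟩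
    rwa [← coord_of_ne, ← chartFold_chartUnfold b y,
      coord_chartFold_pred hab (chartUnfold_nonneg b y) (inChart_iff.mp ha).1, ← unfold_mk, e] at hy
  · rintro ⟨ha, hb, h⟩
    have hb' := inChart_iff.mp hb
    refine ⟨hadj, hb, ha, _, mk_chartFold_unfold hb'.1 hb'.2, ?_⟩
    rwa [← coord_of_ne, coord_chartFold_pred hab (unfold_nonneg x) (inChart_iff.mp ha).1, e]

end Singularity

open Singularity

theorem exists_chart_of_mem {y : Fin (n + 1) → ℝ} (hy : y ∈ doublyVanishing n) :
    ∃ a : Fin n, (∃ i : Fin (n + 1), i.1 ≤ a ∧ y i = 0) ∧ ∃ i : Fin (n + 1), a.1 < i ∧ y i = 0 := by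
  obtain ⟨_, i, j, hij, hi, hj⟩ := hy
  have := Fin.lt_def.mp hij
  exact ⟨⟨i.1, by omega⟩, ⟨i, le_rfl, hi⟩, ⟨j, hij, hj⟩⟩

/-- The singularity of `A_n` is homeomorphic to a fan in `ℝ^(n+1)`. -/
noncomputable def unfoldHomeomorph : Singularity (anTree n) ≃ₜ doublyVanishing n where
  toFun x := ⟨unfold x, unfold_mem x⟩
  invFun y := Singularity.mk _ (exists_chart_of_mem y.2).choose (chartFold _ y.1)
  left_inv x := mk_chartFold_unfold (exists_chart_of_mem (unfold_mem x)).choose_spec.1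
    (exists_chart_of_mem (unfold_mem x)).choose_spec.2
  right_inv y := Subtype.ext (chartUnfold_chartFold _ y.2.1 (exists_chart_of_mem y.2).choose_spec.1
    (exists_chart_of_mem y.2).choose_spec.2)
  continuous_toFun := continuous_unfold.subtype_mk _
  continuous_invFun := by
    -- The inverse picks a chart arbitrarily at each point. The sets on which one fixed chart is
    -- admissible form a finite closed cover, and on each the choice may be replaced by that chart.
    have hcl : ∀ P : Fin (n + 1) → Prop,
        IsClosed {y : doublyVanishing n | ∃ i, P i ∧ y.1 i = 0} := by
      intro P
      have : {y : doublyVanishing n | ∃ i, P i ∧ y.1 i = 0} =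
          ⋃ i : {i // P i}, {y : doublyVanishing n | y.1 i.1 = 0} := by
        ext y; simp
      rw [this]
      exact isClosed_iUnion_of_finite fun i =>
        isClosed_eq ((continuous_apply i.1).comp continuous_subtype_val) continuous_const
    refine (locallyFinite_of_finite fun a : Fin n =>
      {y : doublyVanishing n | ∃ i : Fin (n + 1), i.1 ≤ a ∧ y.1 i = 0} ∩
        {y : doublyVanishing n | ∃ i : Fin (n + 1), a.1 < i ∧ y.1 i = 0}).continuous ?_
      (fun a => (hcl _).inter (hcl _)) fun a => ?_
    · refine Set.eq_univ_of_forall fun y => ?_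
      obtain ⟨a, h1, h2⟩ := exists_chart_of_mem y.2
      exact Set.mem_iUnion.mpr ⟨a, h1, h2⟩
    · refine (((Singularity.continuous_mk a).comp ((continuous_chartFold a).comp
        continuous_subtype_val)).continuousOn).congr fun y hy => ?_
      exact mk_chartFold_eq y.2.1 (exists_chart_of_mem y.2).choose_spec.1
        (exists_chart_of_mem y.2).choose_spec.2 hy.1 hy.2

theorem unfold_unfoldHomeomorph_symm (y : doublyVanishing n) :
    unfold (unfoldHomeomorph.symm y) = y :=
  congrArg Subtype.val (unfoldHomeomorph.apply_symm_apply y)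

theorem radius_eq_zero_iff {x : Singularity (anTree n)} : radius x = 0 ↔ unfold x = 0 := by
  obtain ⟨a, y, rfl⟩ := exists_mk x
  have h0 : chartUnfold a (0 : Chart (Fin n) a) = 0 := by
    have := chartUnfold_smul a le_rfl (0 : Chart (Fin n) a)
    rwa [zero_smul, zero_smul] at this
  rw [radius_mk, nnnorm_eq_zero, unfold_mk]
  constructor
  · rintro rfl
    exact h0
  · intro h
    rw [← chartFold_chartUnfold a y, h, ← h0, chartFold_chartUnfold]

end Unfold

/-! ### The cell of a point is given by the zeros of its unfolding -/

section Cells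

variable {n : ℕ}

open Singularity

theorem Correspondence.eq_of_mem_cell {V : Type*} [Fintype V] [DecidableEq V] {G : SimpleGraph V}
    {p p' : Correspondence G} {x : Singularity G} (h : x ∈ p.cell) (h' : x ∈ p'.cell) :
    p = p' := by
  refine ext_related fun u v => ?_
  have hc : ∀ u, u ∈ p.carrier ↔ u ∈ p'.carrier := fun u => (h.1 u).trans (h'.1 u).symm
  constructor
  · rintro ⟨hu, hv, hr⟩
    exact ⟨(hc u).mp hu, (hc v).mp hv, (h'.2 _ _).mpr ((h.2 ⟨u, hu⟩ ⟨v, hv⟩).mp hr)⟩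
  · rintro ⟨hu, hv, hr⟩
    exact ⟨(hc u).mpr hu, (hc v).mpr hv, (h.2 _ _).mpr ((h'.2 ⟨u, hu⟩ ⟨v, hv⟩).mp hr)⟩

theorem mem_cell_ofGaps_of_zeros {x : Singularity (anTree n)} {B : Finset (Fin (n + 1))}
    (hB : 2 ≤ B.card) (h : ∀ i, i ∈ B ↔ unfold x i = 0) :
    x ∈ (Correspondence.ofGaps B hB).cell := by
  have hchart : ∀ k, k ∈ (Correspondence.ofGaps B hB).carrier ↔ x.InChart k := by
    intro k
    rw [inChart_iff, Correspondence.mem_ofGaps]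
    simp only [h, and_comm]
  have hstep : ∀ k l : Fin n, k.1 + 1 = l → 0 < unfold x l.castSucc →
      ∀ b ∈ B, b.1 ≤ k.1 ↔ b.1 ≤ l.1 := by
    intro k l hkl hpos b hb
    refine ⟨fun h => by omega, fun hbl => ?_⟩
    by_contra hbk
    have : b = l.castSucc := Fin.ext (by simp only [Fin.val_castSucc]; omega)
    rw [← this, (h b).mp hb] at hpos
    exact hpos.false
  have hpos : ∀ d (k l : Fin n), k.1 + d = l → x.InChart k → x.InChart l →
      (∀ b ∈ B, b.1 ≤ k.1 ↔ b.1 ≤ l.1) → Relation.EqvGen x.PosEdge k l := by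
    intro d
    induction d with
    | zero =>
      intro k l hd _ _ _
      obtain rfl : k = l := Fin.ext hd
      exact .refl _
    | succ d ih =>
      intro k l hd hk hl hr
      let m : Fin n := ⟨k.1 + d, by omega⟩
      have hmv : m.1 = k.1 + d := rfl
      have hm : x.InChart m := by
        rw [← hchart] at hk hl ⊢
        exact Correspondence.mem_of_between _ hk hl (Fin.le_def.mpr (by omega))
          (Fin.le_def.mpr (by omega))
      refine (ih k m rfl hk hm fun b hb => by have := hr b hb; omega).trans _ _ _ (.rel _ _ ?_)
      refine (posEdge_iff_of_succ (by omega)).mpr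
        ⟨hm, hl, lt_of_le_of_ne (unfold_nonneg _ _) fun h0 => ?_⟩
      have := hr _ ((h l.castSucc).mpr h0.symm)
      simp only [Fin.val_castSucc] at this
      omega
  refine ⟨hchart, fun s t => ⟨fun hr => ?_, fun hr => ?_⟩⟩
  · have hs := (hchart s).mp s.2
    have ht := (hchart t).mp t.2
    rcases le_total s.1.1 t.1.1 with hst | hst
    · exact hpos (t.1.1 - s.1.1) s t (by omega) hs ht hr
    · exact (hpos (s.1.1 - t.1.1) t s (by omega) ht hs fun b hb => (hr b hb).symm).symm
  -- The gap of a positive edge carries a nonzero value, so crossing it passes no element of `B`.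
  · have key : ∀ k l, Relation.EqvGen x.PosEdge k l → ∀ b ∈ B, b.1 ≤ k.1 ↔ b.1 ≤ l.1 := by
      intro k l hkl
      induction hkl with
      | rel k l hkl =>
        rcases Correspondence.anTree_adj.mp hkl.1 with e | e
        · exact hstep k l e ((posEdge_iff_of_succ e).mp hkl).2.2
        · exact fun b hb => (hstep l k e ((posEdge_iff_of_pred e).mp hkl).2.2 b hb).symm
      | refl => exact fun _ _ => Iff.rfl
      | symm _ _ _ ih => exact fun b hb => (ih b hb).symm
      | trans _ _ _ _ _ ih ih' => exact fun b hb => (ih b hb).trans (ih' b hb)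
    exact key s t hr

theorem two_le_card_iff_exists_lt {m : ℕ} {B : Finset (Fin m)} :
    2 ≤ B.card ↔ ∃ i j, i < j ∧ i ∈ B ∧ j ∈ B := by
  rw [Nat.succ_le_iff, Finset.one_lt_card]
  constructor
  · rintro ⟨i, hi, j, hj, hne⟩
    rcases lt_or_gt_of_ne hne with h | h
    exacts [⟨i, j, h, hi, hj⟩, ⟨j, i, h, hj, hi⟩]
  · rintro ⟨i, j, h, hi, hj⟩
    exact ⟨i, hi, j, hj, h.ne⟩

/-- A point lies in the cell of its own zero set and in no other cell, and `B` is determined by its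
correspondence. -/
theorem mem_cell_ofGaps_iff {x : Singularity (anTree n)} {B : Finset (Fin (n + 1))}
    {hB : 2 ≤ B.card} :
    x ∈ (Correspondence.ofGaps B hB).cell ↔ ∀ i, i ∈ B ↔ unfold x i = 0 := by
  refine ⟨fun hx => ?_, mem_cell_ofGaps_of_zeros hB⟩
  have hZ : ∀ i, i ∈ Finset.univ.filter (fun i => unfold x i = 0) ↔ unfold x i = 0 := by simp
  have hZ2 : 2 ≤ (Finset.univ.filter fun i => unfold x i = 0).card := by
    obtain ⟨i, j, hij, hi, hj⟩ := (unfold_mem x).2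
    exact two_le_card_iff_exists_lt.mpr ⟨i, j, hij, (hZ i).mpr hi, (hZ j).mpr hj⟩
  rwa [Correspondence.ofGaps_injective
    (Correspondence.eq_of_mem_cell hx (mem_cell_ofGaps_of_zeros hZ2 hZ))]

end Cells

end Arboreal

namespace Arboreal

open Singularity

/-! ### The radial coordinate and neighbourhoods of the cone point -/

section ConeRadius

/-- The inverse `t ↦ t / (1 - t)` of `coneRadius`. -/
noncomputable def coneRadiusInv (t : Set.Ico (0 : ℝ) 1) : ℝ≥0 :=
  ⟨(t : ℝ) / (1 - t), div_nonneg t.2.1 (sub_nonneg.mpr t.2.2.le)⟩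

theorem coneRadius_coneRadiusInv (t : Set.Ico (0 : ℝ) 1) : coneRadius (coneRadiusInv t) = t := by
  have h : 1 - (t : ℝ) ≠ 0 := (sub_pos.mpr t.2.2).ne'
  refine Subtype.ext ?_
  change (t : ℝ) / (1 - t) / (1 + t / (1 - t)) = t
  field_simp
  ring

theorem coneRadiusInv_coneRadius (r : ℝ≥0) : coneRadiusInv (coneRadius r) = r := by
  have h : 1 + (r : ℝ) ≠ 0 := by positivity
  refine NNReal.eq ?_
  change (r : ℝ) / (1 + r) / (1 - r / (1 + r)) = r
  field_simp
  ring

theorem continuous_coneRadius : Continuous coneRadius :=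
  (NNReal.continuous_coe.div (continuous_const.add NNReal.continuous_coe)
    fun r => (add_pos_of_pos_of_nonneg one_pos r.2).ne').subtype_mk _

theorem continuous_coneRadiusInv : Continuous coneRadiusInv :=
  (continuous_subtype_val.div (continuous_const.sub continuous_subtype_val)
    fun t => (sub_pos.mpr t.2.2).ne').subtype_mk _

theorem coneRadius_zero : (coneRadius 0 : ℝ) = 0 := by simp [coneRadius]

theorem coneRadiusInv_eq_zero {t : Set.Ico (0 : ℝ) 1} : coneRadiusInv t = 0 ↔ (t : ℝ) = 0 := by
  constructor
  · intro h
    rw [← coneRadius_coneRadiusInv t, h, coneRadius_zero]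
  · intro h
    exact NNReal.eq (by change (t : ℝ) / (1 - t) = 0; rw [h, zero_div])

theorem coneRadius_pos {r : ℝ≥0} (hr : r ≠ 0) : 0 < (coneRadius r : ℝ) := by
  refine lt_of_le_of_ne (coneRadius r).2.1 fun h => hr ?_
  rw [← coneRadiusInv_coneRadius r, coneRadiusInv_eq_zero, ← h]

theorem Cone.mk_eq_apex {X : Type*} (x : X) {t : Set.Ico (0 : ℝ) 1} (ht : (t : ℝ) = 0) :
    Cone.mk x t = Cone.apex X :=
  Quot.sound (.glue x t ht)

theorem Cone.continuous_mk {X : Type*} [TopologicalSpace X] :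
    Continuous fun p : X × Set.Ico (0 : ℝ) 1 => Cone.mk p.1 p.2 :=
  continuous_quot_mk.comp continuous_inl

/-- The open neighbourhoods of the cone point of the cone over a compact space are uniform. -/
theorem Cone.eventually_mk_mem {X : Type*} [TopologicalSpace X] [CompactSpace X] {U : Set (Cone X)}
    (hU : IsOpen U) (h : Cone.apex X ∈ U) :
    ∀ᶠ r in nhds (0 : ℝ≥0), ∀ x : X, Cone.mk x (coneRadius r) ∈ U := by
  have hV : IsOpen {p : ℝ≥0 × X | Cone.mk p.2 (coneRadius p.1) ∈ U} :=
    hU.preimage (Cone.continuous_mk.comp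
      (continuous_snd.prodMk (continuous_coneRadius.comp continuous_fst)))
  obtain ⟨u, v, hu, -, hu0, hv, huv⟩ := generalized_tube_lemma (isCompact_singleton (x := (0 : ℝ≥0)))
    (isCompact_univ (X := X)) hV (by
      rintro ⟨r, x⟩ ⟨hr, -⟩
      obtain rfl : r = 0 := hr
      change Cone.mk x (coneRadius 0) ∈ U
      rwa [Cone.mk_eq_apex x coneRadius_zero])
  filter_upwards [hu.mem_nhds (hu0 rfl)] with r hr x
  exact huv (Set.mk_mem_prod hr (hv (Set.mem_univ x)))

end ConeRadius

/-! ### Polar coordinates on the singularity -/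

section Polar

variable {n : ℕ}

/-- Joint continuity is read off in the fan, where dilation is scalar multiplication. -/
theorem continuous_dilate :
    Continuous fun p : ℝ≥0 × Singularity (anTree n) => dilate p.1 p.2 := by
  rw [← unfoldHomeomorph.comp_continuous_iff]
  refine Continuous.subtype_mk (?_ : Continuous fun p : ℝ≥0 × Singularity (anTree n) =>
    unfold (dilate p.1 p.2)) _
  simp only [unfold_dilate]
  exact (NNReal.continuous_coe.comp continuous_fst).smul (continuous_unfold.comp continuous_snd)

theorem zero_mem_doublyVanishing (hn : 1 ≤ n) : (0 : Fin (n + 1) → ℝ) ∈ doublyVanishing n :=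
  ⟨fun _ => le_rfl, 0, Fin.last n, Fin.lt_def.mpr hn, rfl, rfl⟩

/-- The central point. -/
noncomputable def origin (hn : 1 ≤ n) : Singularity (anTree n) :=
  unfoldHomeomorph.symm ⟨0, zero_mem_doublyVanishing hn⟩

theorem eq_origin_iff (hn : 1 ≤ n) {x : Singularity (anTree n)} :
    x = origin hn ↔ radius x = 0 := by
  rw [radius_eq_zero_iff, ← unfold_injective.eq_iff, origin, unfold_unfoldHomeomorph_symm]

theorem dilate_zero (hn : 1 ≤ n) (x : Singularity (anTree n)) : dilate 0 x = origin hn := by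
  rw [eq_origin_iff, radius_dilate, zero_mul]

/-- The radial projection to the link. -/
noncomputable def toLink (x : Singularity (anTree n)) (hx : radius x ≠ 0) : link (anTree n) :=
  ⟨dilate (radius x)⁻¹ x, by rw [mem_link_iff, radius_dilate, inv_mul_cancel₀ hx]⟩

theorem dilate_radius_toLink (x : Singularity (anTree n)) (hx : radius x ≠ 0) :
    dilate (radius x) (toLink x hx).1 = x := dilate_dilate_inv hx x

variable {X : Type*} [TopologicalSpace X]

open Classical in
/-- Polar coordinates. -/
noncomputable def toCone (g : link (anTree n) ≃ₜ X) (x : Singularity (anTree n)) : Cone X :=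
  if hx : radius x = 0 then Cone.apex X else Cone.mk (g (toLink x hx)) (coneRadius (radius x))

theorem toCone_of_radius_eq_zero (g : link (anTree n) ≃ₜ X) {x : Singularity (anTree n)}
    (hx : radius x = 0) : toCone g x = Cone.apex X := dif_pos hx

theorem toCone_of_radius_ne_zero (g : link (anTree n) ≃ₜ X) {x : Singularity (anTree n)}
    (hx : radius x ≠ 0) : toCone g x = Cone.mk (g (toLink x hx)) (coneRadius (radius x)) :=
  dif_neg hx

theorem toCone_dilate (g : link (anTree n) ≃ₜ X) (x : link (anTree n)) (r : ℝ≥0) :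
    toCone g (dilate r x.1) = Cone.mk (g x) (coneRadius r) := by
  have hr : radius (dilate r x.1) = r := by rw [radius_dilate, mem_link_iff.mp x.2, mul_one]
  by_cases h0 : r = 0
  · rw [toCone_of_radius_eq_zero g (hr.trans h0), Cone.mk_eq_apex _ (by rw [h0, coneRadius_zero])]
  · have hx : radius (dilate r x.1) ≠ 0 := by rwa [hr]
    have e : toLink (dilate r x.1) hx = x := Subtype.ext (by
      change dilate (radius (dilate r x.1))⁻¹ (dilate r x.1) = x.1
      rw [hr, dilate_dilate, inv_mul_cancel₀ h0, dilate_one])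
    rw [toCone_of_radius_ne_zero g hx, e, hr]

/-- At radius zero the direction is lost, and compactness of the link makes neighbourhoods of the
apex uniform in it. Elsewhere the polar formula is continuous. -/
theorem continuous_toCone (g : link (anTree n) ≃ₜ X) : Continuous (toCone g) := by
  have : CompactSpace X := g.compactSpace
  rw [continuous_iff_continuousAt]
  intro x
  by_cases hx : radius x = 0
  · refine continuousAt_def.mpr fun S hS => ?_
    obtain ⟨U, hUS, hU, hxU⟩ := mem_nhds_iff.mp hS
    rw [toCone_of_radius_eq_zero g hx] at hxU
    have h := continuous_radius.continuousAt.eventually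
      (hx ▸ Cone.eventually_mk_mem hU hxU : ∀ᶠ r in nhds (radius x), _)
    filter_upwards [h] with y hy
    refine hUS ?_
    by_cases hy0 : radius y = 0
    · rwa [toCone_of_radius_eq_zero g hy0]
    · rw [toCone_of_radius_ne_zero g hy0]
      exact hy _
  · have ho : IsOpen {y : Singularity (anTree n) | radius y ≠ 0} :=
      isOpen_ne_fun continuous_radius continuous_const
    refine (ho.isOpenEmbedding_subtypeVal.continuousAt_iff (x := ⟨x, hx⟩)).mp
      (Continuous.continuousAt ?_)
    have e : toCone g ∘ Subtype.val = fun y : {y : Singularity (anTree n) | radius y ≠ 0} =>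
        Cone.mk (g (toLink y.1 y.2)) (coneRadius (radius y.1)) :=
      funext fun y => toCone_of_radius_ne_zero g y.2
    have hrad : Continuous fun y : {y : Singularity (anTree n) | radius y ≠ 0} => radius y.1 :=
      continuous_radius.comp continuous_subtype_val
    rw [e]
    exact Cone.continuous_mk.comp ((g.continuous.comp ((continuous_dilate.comp
      ((hrad.inv₀ fun y => y.2).prodMk continuous_subtype_val)).subtype_mk _)).prodMk
        (continuous_coneRadius.comp hrad))

/-- The singularity of `A_n` is the cone over its link. -/
noncomputable def coneHomeomorph (hn : 1 ≤ n) (g : link (anTree n) ≃ₜ X) :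
    Singularity (anTree n) ≃ₜ Cone X where
  toFun := toCone g
  invFun := Quot.lift (Sum.elim (fun p => dilate (coneRadiusInv p.2) (g.symm p.1).1)
    fun _ => origin hn) (by
      rintro _ _ ⟨x, t, ht⟩
      change dilate (coneRadiusInv t) _ = origin hn
      rw [coneRadiusInv_eq_zero.mpr ht, dilate_zero hn])
  left_inv x := by
    by_cases hx : radius x = 0
    · rw [toCone_of_radius_eq_zero g hx]
      exact ((eq_origin_iff hn).mpr hx).symm
    · rw [toCone_of_radius_ne_zero g hx]
      change dilate (coneRadiusInv (coneRadius (radius x))) (g.symm (g (toLink x hx))).1 = x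
      rw [coneRadiusInv_coneRadius, g.symm_apply_apply, dilate_radius_toLink]
  right_inv z := by
    obtain ⟨⟨u, t⟩ | ⟨⟩, rfl⟩ := Quot.exists_rep z
    · refine (toCone_dilate g (g.symm u) (coneRadiusInv t)).trans ?_
      rw [g.apply_symm_apply, coneRadius_coneRadiusInv]
      rfl
    · exact toCone_of_radius_eq_zero g ((eq_origin_iff hn).mp rfl)
  continuous_toFun := continuous_toCone g
  continuous_invFun := continuous_quot_lift _ (Continuous.sumElim
    (continuous_dilate.comp ((continuous_coneRadiusInv.comp continuous_snd).prodMk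
      (continuous_subtype_val.comp (g.symm.continuous.comp continuous_fst)))) continuous_const)

end Polar

/-! ### From the unit sphere to the simplex: norm against coordinate sum -/

section LinkSkeleton

variable {n : ℕ}

/-- The sum of the coordinates of the unfolding. -/
noncomputable def total (x : Singularity (anTree n)) : ℝ≥0 := (∑ i, unfold x i).toNNReal

theorem coe_total (x : Singularity (anTree n)) : (total x : ℝ) = ∑ i, unfold x i :=
  Real.coe_toNNReal _ (Finset.sum_nonneg fun i _ => unfold_nonneg x i)

theorem continuous_total : Continuous (total (n := n)) :=
  continuous_real_toNNReal.comp
    (continuous_finsetSum _ fun i _ => (continuous_apply i).comp continuous_unfold)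

theorem total_dilate (r : ℝ≥0) (x : Singularity (anTree n)) : total (dilate r x) = r * total x := by
  refine NNReal.eq ?_
  rw [NNReal.coe_mul, coe_total, coe_total, unfold_dilate, Finset.mul_sum]
  rfl

theorem total_eq_zero_iff {x : Singularity (anTree n)} : total x = 0 ↔ radius x = 0 := by
  rw [radius_eq_zero_iff, ← NNReal.coe_eq_zero, coe_total,
    Finset.sum_eq_zero_iff_of_nonneg fun i _ => unfold_nonneg x i, funext_iff]
  simp

/-- A face of dimension at most `n - 2` has at most `n - 1` of the `n + 1` vertices, so it misses at
least two. -/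
theorem mem_skeleton_iff {y : Fin (n + 1) → ℝ} :
    y ∈ skeleton n ((n : ℤ) - 2) ↔ y ∈ doublyVanishing n ∧ ∑ i, y i = 1 := by
  constructor
  · rintro ⟨A, -, hA, ⟨h0, h1⟩, hy⟩
    have hc := A.card_compl_add_card
    rw [Fintype.card_fin] at hc
    obtain ⟨i, j, hij, hi, hj⟩ := two_le_card_iff_exists_lt.mp (show 2 ≤ Aᶜ.card by omega)
    exact ⟨⟨h0, i, j, hij, hy i (Finset.mem_compl.mp hi), hy j (Finset.mem_compl.mp hj)⟩, h1⟩
  · rintro ⟨⟨h0, i, j, hij, hi, hj⟩, h1⟩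
    let A : Finset (Fin (n + 1)) := Finset.univ.filter fun i => y i ≠ 0
    have hA : ∀ i, i ∉ A → y i = 0 := fun i hi => by simpa [A] using hi
    have hc := A.card_compl_add_card
    rw [Fintype.card_fin] at hc
    have h2 : 2 ≤ Aᶜ.card :=
      two_le_card_iff_exists_lt.mpr ⟨i, j, hij, by simpa [A] using hi, by simpa [A] using hj⟩
    refine ⟨A, ?_, by omega, ⟨h0, h1⟩, hA⟩
    by_contra hne
    rw [Finset.not_nonempty_iff_eq_empty] at hne
    rw [Finset.sum_eq_zero fun i _ => hA i (by simp [hne])] at h1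
    exact zero_ne_one h1

theorem unfold_mem_skeleton {x : Singularity (anTree n)} (hx : total x = 1) :
    unfold x ∈ skeleton n ((n : ℤ) - 2) :=
  mem_skeleton_iff.mpr ⟨unfold_mem x, by rw [← coe_total, hx, NNReal.coe_one]⟩

/-- The point of the singularity with given unfolding in the skeleton. -/
noncomputable def ofSkeleton (u : skeleton n ((n : ℤ) - 2)) :
    Singularity (anTree n) :=
  unfoldHomeomorph.symm ⟨u, (mem_skeleton_iff.mp u.2).1⟩

theorem unfold_ofSkeleton (u : skeleton n ((n : ℤ) - 2)) :
    unfold (ofSkeleton u) = u := unfold_unfoldHomeomorph_symm _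

theorem continuous_ofSkeleton : Continuous (ofSkeleton (n := n)) :=
  unfoldHomeomorph.symm.continuous.comp (continuous_subtype_val.subtype_mk _)

theorem total_ofSkeleton (u : skeleton n ((n : ℤ) - 2)) :
    total (ofSkeleton u) = 1 :=
  NNReal.eq (by rw [coe_total, unfold_ofSkeleton, (mem_skeleton_iff.mp u.2).2, NNReal.coe_one])

theorem radius_ofSkeleton_ne_zero (u : skeleton n ((n : ℤ) - 2)) :
    radius (ofSkeleton u) ≠ 0 := by
  rw [Ne, ← total_eq_zero_iff, total_ofSkeleton]
  exact one_ne_zero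

theorem total_link_ne_zero (x : link (anTree n)) : total x.1 ≠ 0 := by
  rw [Ne, total_eq_zero_iff, mem_link_iff.mp x.2]
  exact one_ne_zero

/-- The link of `A_n` is the skeleton of the simplex, by radial projection of the unfolding. -/
noncomputable def linkHomeomorph :
    link (anTree n) ≃ₜ skeleton n ((n : ℤ) - 2) where
  toFun x := ⟨unfold (dilate (total x.1)⁻¹ x.1), unfold_mem_skeleton (by
    rw [total_dilate, inv_mul_cancel₀ (total_link_ne_zero x)])⟩
  invFun u := toLink (ofSkeleton u) (radius_ofSkeleton_ne_zero u)
  left_inv x := by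
    refine Subtype.ext ?_
    have h : unfold (dilate (total x.1)⁻¹ x.1) ∈ skeleton n ((n : ℤ) - 2) :=
      unfold_mem_skeleton (by rw [total_dilate, inv_mul_cancel₀ (total_link_ne_zero x)])
    have e : ofSkeleton ⟨_, h⟩ = dilate (total x.1)⁻¹ x.1 :=
      unfold_injective (unfold_ofSkeleton _)
    change dilate (radius (ofSkeleton ⟨_, h⟩))⁻¹ (ofSkeleton ⟨_, h⟩) = x.1
    rw [e, radius_dilate, mem_link_iff.mp x.2, mul_one, inv_inv,
      dilate_dilate_inv (total_link_ne_zero x)]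
  right_inv u := by
    refine Subtype.ext ?_
    have hr := radius_ofSkeleton_ne_zero u
    change unfold (dilate (total (dilate (radius (ofSkeleton u))⁻¹ (ofSkeleton u)))⁻¹
      (dilate (radius (ofSkeleton u))⁻¹ (ofSkeleton u))) = u.1
    rw [total_dilate, total_ofSkeleton, mul_one, inv_inv, dilate_dilate_inv hr, unfold_ofSkeleton]
  continuous_toFun := (continuous_unfold.comp (continuous_dilate.comp
    (((continuous_total.comp continuous_subtype_val).inv₀ total_link_ne_zero).prodMk
      continuous_subtype_val))).subtype_mk _
  continuous_invFun := (continuous_dilate.comp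
    (((continuous_radius.comp continuous_ofSkeleton).inv₀
      radius_ofSkeleton_ne_zero).prodMk continuous_ofSkeleton)).subtype_mk _

theorem unfold_dilate_ne_zero_iff {r : ℝ≥0} (hr : r ≠ 0) (x : Singularity (anTree n))
    (i : Fin (n + 1)) : unfold (dilate r x) i ≠ 0 ↔ unfold x i ≠ 0 := by
  simp [unfold_dilate, hr]

theorem linkHomeomorph_mem_openFace_iff (x : link (anTree n))
    (A : Finset (Fin (n + 1))) :
    (linkHomeomorph x : Fin (n + 1) → ℝ) ∈ openFace A ↔ ∀ i, unfold x.1 i ≠ 0 ↔ i ∈ A := by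
  have hm := mem_skeleton_iff.mp (linkHomeomorph x).2
  have h : ∀ i, (linkHomeomorph x : Fin (n + 1) → ℝ) i ≠ 0 ↔ unfold x.1 i ≠ 0 :=
    unfold_dilate_ne_zero_iff (inv_ne_zero (total_link_ne_zero x)) x.1
  refine ⟨fun hx i => (h i).symm.trans (hx.2 i), fun hx => ⟨⟨hm.1.1, hm.2⟩, fun i =>
    (h i).trans (hx i)⟩⟩

end LinkSkeleton

/-! ### Correspondences and faces -/

section FaceIso

variable {n : ℕ}

theorem two_le_card_compl (hn : 1 ≤ n) {A : Finset (Fin (n + 1))} :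
    2 ≤ Aᶜ.card ↔ A.card ≤ n - 1 := by
  have hc := A.card_compl_add_card
  rw [Fintype.card_fin] at hc
  omega

/-- The correspondence of `A_n` given by the complement of a set of gaps. -/
def ofFace (hn : 1 ≤ n) (A : {A : Finset (Fin (n + 1)) // A.Nonempty ∧ A.card ≤ n - 1}) :
    {p : Correspondence (anTree n) // p ≠ Correspondence.identity (anTree_connected hn)} :=
  ⟨Correspondence.ofGaps A.1ᶜ ((two_le_card_compl hn).mpr A.2.2), fun h => by
    rw [← Correspondence.ofGaps_univ hn (by simpa using hn)] at h
    have := Correspondence.ofGaps_injective h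
    rw [Finset.compl_eq_univ_iff] at this
    exact A.2.1.ne_empty this⟩

theorem ofFace_bijective (hn : 1 ≤ n) : Function.Bijective (ofFace hn) := by
  constructor
  · intro A A' h
    exact Subtype.ext (compl_injective
      (Correspondence.ofGaps_injective (hB := (two_le_card_compl hn).mpr A.2.2)
        (hB' := (two_le_card_compl hn).mpr A'.2.2) (congrArg Subtype.val h)))
  · rintro ⟨p, hp⟩
    obtain ⟨B, hB, rfl⟩ := p.exists_eq_ofGaps
    refine ⟨⟨Bᶜ, ?_, ?_⟩, Subtype.ext ?_⟩
    · rw [Finset.nonempty_iff_ne_empty, Ne, Finset.compl_eq_empty_iff]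
      rintro rfl
      exact hp (Correspondence.ofGaps_univ hn hB)
    · rwa [← two_le_card_compl hn, compl_compl]
    · simp only [ofFace, compl_compl]

/-- The poset of nontrivial correspondences of `A_n` is the face poset of the skeleton. -/
noncomputable def faceIso (hn : 1 ≤ n) :
    {p : Correspondence (anTree n) // p ≠ Correspondence.identity (anTree_connected hn)} ≃o
      {A : Finset (Fin (n + 1)) // A.Nonempty ∧ A.card ≤ n - 1} :=
  RelIso.symm
    { Equiv.ofBijective _ (ofFace_bijective hn) with
      -- The order on correspondences reverses inclusion of gap sets, and so do complements; the two
      -- reversals cancel.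
      map_rel_iff' := fun {A A'} =>
        (Correspondence.ofGaps_le_ofGaps (hB := (two_le_card_compl hn).mpr A'.2.2)
          (hB' := (two_le_card_compl hn).mpr A.2.2)).trans Finset.compl_subset_compl }

theorem mem_cell_iff (hn : 1 ≤ n) (p : {p : Correspondence (anTree n) //
    p ≠ Correspondence.identity (anTree_connected hn)}) (x : Singularity (anTree n)) :
    x ∈ p.1.cell ↔ ∀ i, unfold x i ≠ 0 ↔ i ∈ (faceIso hn p).1 := by
  obtain ⟨A, rfl⟩ := (faceIso hn).symm.surjective p
  rw [OrderIso.apply_symm_apply]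
  change x ∈ (Correspondence.ofGaps A.1ᶜ ((two_le_card_compl hn).mpr A.2.2)).cell ↔ _
  rw [mem_cell_ofGaps_iff]
  refine forall_congr' fun i => ?_
  rw [Finset.mem_compl]
  tauto

theorem dilate_mem_cell_iff (hn : 1 ≤ n) {p : {p : Correspondence (anTree n) //
    p ≠ Correspondence.identity (anTree_connected hn)}} {r : ℝ≥0} (hr : r ≠ 0)
    {x : Singularity (anTree n)} : dilate r x ∈ p.1.cell ↔ x ∈ p.1.cell := by
  rw [mem_cell_iff hn, mem_cell_iff hn]
  exact forall_congr' fun i => by rw [unfold_dilate_ne_zero_iff hr]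

theorem radius_ne_zero_of_mem_cell (hn : 1 ≤ n) {p : {p : Correspondence (anTree n) //
    p ≠ Correspondence.identity (anTree_connected hn)}} {x : Singularity (anTree n)}
    (hx : x ∈ p.1.cell) : radius x ≠ 0 := by
  obtain ⟨i, hi⟩ := (faceIso hn p).2.1
  intro h
  exact ((mem_cell_iff hn p x).mp hx i).mpr hi (congrFun (radius_eq_zero_iff.mp h) i)

theorem mem_cell_identity_iff (hn : 1 ≤ n) {x : Singularity (anTree n)} :
    x ∈ (Correspondence.identity (anTree_connected hn)).cell ↔ x = origin hn := by
  rw [← Correspondence.ofGaps_univ hn (by simpa using hn), mem_cell_ofGaps_iff, eq_origin_iff,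
    radius_eq_zero_iff, funext_iff]
  simp

end FaceIso

end Arboreal

/-! ### Assembly of the poset isomorphism and the two homeomorphisms -/

theorem mainTheorem7 (n : ℕ) (hn : 1 ≤ n) :
    ∃ (φ : {p : Arboreal.Correspondence (Arboreal.anTree n) //
            p ≠ Arboreal.Correspondence.identity (Arboreal.anTree_connected hn)} ≃o
          {A : Finset (Fin (n + 1)) // A.Nonempty ∧ A.card ≤ n - 1})
      (g : Arboreal.link (Arboreal.anTree n) ≃ₜ Arboreal.skeleton n ((n : ℤ) - 2))
      (h : Arboreal.Singularity (Arboreal.anTree n) ≃ₜ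
          Arboreal.Cone (Arboreal.skeleton n ((n : ℤ) - 2))),
      -- the link and the skeleton are identified cell by cell
      (∀ p, g '' (Subtype.val ⁻¹' p.1.cell) = Subtype.val ⁻¹' Arboreal.openFace (φ p).1) ∧
      -- the singularity and the cone are identified cell by cell
      h '' (Arboreal.Correspondence.identity (Arboreal.anTree_connected hn)).cell =
          {Arboreal.Cone.apex _} ∧
      (∀ p, h '' p.1.cell =
          Arboreal.Cone.over (Subtype.val ⁻¹' Arboreal.openFace (φ p).1)) ∧
      -- compatibly with the conical structure given by dilation
      ∀ (x : Arboreal.link (Arboreal.anTree n)) (r : NNReal),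
        h (Arboreal.Singularity.dilate r x.1) =
          Arboreal.Cone.mk (g x) (Arboreal.coneRadius r) := by

  -- Cells and open faces are both detected by the support of the unfolding, which positive
  -- rescaling preserves.
  have key : ∀ p (x : Arboreal.link (Arboreal.anTree n)), x.1 ∈ p.1.cell ↔
      (Arboreal.linkHomeomorph x).1 ∈ Arboreal.openFace (Arboreal.faceIso hn p).1 := fun p x =>
    (Arboreal.mem_cell_iff hn p x.1).trans
      (Arboreal.linkHomeomorph_mem_openFace_iff x _).symm
  refine ⟨Arboreal.faceIso hn, Arboreal.linkHomeomorph,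
    Arboreal.coneHomeomorph hn Arboreal.linkHomeomorph, fun p => ?_, ?_, fun p => ?_,
    Arboreal.toCone_dilate _⟩
  · ext u
    constructor
    · rintro ⟨x, hx, rfl⟩
      exact (key p x).mp hx
    · intro hu
      refine ⟨Arboreal.linkHomeomorph.symm u, (key p _).mpr ?_, Homeomorph.apply_symm_apply _ u⟩
      rwa [Homeomorph.apply_symm_apply]
  · have : (Arboreal.Correspondence.identity (Arboreal.anTree_connected hn)).cell =
        {Arboreal.origin hn} := Set.ext fun x => Arboreal.mem_cell_identity_iff hn
    rw [this, Set.image_singleton]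
    exact congrArg _ (Arboreal.toCone_of_radius_eq_zero _ ((Arboreal.eq_origin_iff hn).mp rfl))
  · ext z
    constructor
    · rintro ⟨x, hx, rfl⟩
      have h0 := Arboreal.radius_ne_zero_of_mem_cell hn hx
      refine ⟨_, (key p (Arboreal.toLink x h0)).mp ?_, _, Arboreal.coneRadius_pos h0,
        (Arboreal.toCone_of_radius_ne_zero _ h0).symm⟩
      exact (Arboreal.dilate_mem_cell_iff hn (inv_ne_zero h0)).mpr hx
    · rintro ⟨u, hu, t, ht, rfl⟩
      obtain ⟨x, rfl⟩ := Arboreal.linkHomeomorph.surjective u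
      refine ⟨Arboreal.Singularity.dilate (Arboreal.coneRadiusInv t) x.1,
        (Arboreal.dilate_mem_cell_iff hn fun h => ?_).mpr ((key p x).mpr hu), ?_⟩
      · exact ht.ne' (Arboreal.coneRadiusInv_eq_zero.mp h)
      · refine (Arboreal.toCone_dilate _ x _).trans ?_
        rw [Arboreal.coneRadius_coneRadiusInv]
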